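/- **Theorem (ultra-sparse outcome model).** Consider a sequence of experiments with even sample sizes $n=2m$, $m\to\infty$, and dimensions $p=p_m\to\infty$; laws and parameters may change with $m$. In each experiment we observe $n$ i.i.d. copies of $(X,W,Y)$, where $X\in\mathbb{R}^p$, $W\in\{0,1\}$ and $Y=Y(W)$ for potential outcomes $Y(0),Y(1)$. Write $\mu_{(1)}=\mathbb{E}\,Y(1)$ and $q(z)=1+e^{-z}$. Suppose that for some $\beta_{(1)},\theta_{(1)}\in\mathbb{R}^p$ $$\mathbb{E}[Y(1)\mid X]=X'\beta_{(1)},\qquad \mathbb{P}(W=1\mid X)=\frac{1}{1+\exp(-X'\theta_{(1)})},$$ and that $\varepsilon_{(1)}=Y(1)-X'\beta_{(1)}$ and $v_{(1)}=W-\mathbb{P}(W=1\mid X)$ are conditionally independent given $X$. Suppose moreover that there are constants $a,b,c_{\min}>0,c_{\max},K_X,K_\varepsilon,r,\kappa$, not depending on $m$, such that $X\in[a,b]^p$ almost surely; $\|\theta_{(1)}\|_1\le r$ and $\|\theta_{(1)}\|_1\le\kappa$; all eigenvalues of $\mathbb{E}[XX']$ lie in $[c_{\min},c_{\max}]$ (eigenvalue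 assumption); and $\sup_{\|u\|_2=1}\|X'u\|_{\psi_2}\le K_X$ and $\|\varepsilon_{(1)}\|_{\psi_2}\le K_\varepsilon$ (model assumption), where $\|Z\|_{\psi_2}=\inf\{K>0:\mathbb{E}e^{Z^2/K^2}\le 2\}$. *Estimator.* Split $\{1,\dots,n\}$ into $\mathcal{J}$ and $\mathcal{J}^c$ with $|\mathcal{J}|=|\mathcal{J}^c|=n/2$. For $F\in\{\mathcal{J},\mathcal{J}^c\}$ let $$\check\theta_F\in\arg\min_{\theta}\Big\{\tfrac{1}{|F|}\sum_{i\in F}\big[(1-W_i)X_i'\theta+W_ie^{-X_i'\theta}\big]+\lambda_\theta\|\theta\|_1\Big\}.$$ If $\|\check\theta_F\|_1\le\kappa$ put $\hat\theta_F=\check\theta_F$; otherwise let $\hat\theta_F$ minimize $\|\theta\|_1$ subject to $\big\|\tfrac{1}{|F|}\sum_{i\in F}[1-W_iq(X_i'\theta)]X_i\big\|_\infty\le\lambda_\theta$. Here $\hat\theta_F$ is a measurable function of $(X_i,W_i)_{i\in F}$ (arbitrary where a minimizer does not exist). Let $$\hat\beta_F\in\arg\min_\beta\Big\{\tfrac{1}{|F|}\sum_{i\in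 F}W_ie^{-X_i'\hat\theta_F}(Y_i-X_i'\beta)^2+\lambda_\beta\|\beta\|_1\Big\},$$ $$\hat\mu_F=\tfrac{1}{|F|}\sum_{i\in F}\big[X_i'\hat\beta_{F^c}+q(X_i'\hat\theta_F)W_i(Y_i-X_i'\hat\beta_{F^c})\big],\qquad \hat\mu_{(1)}=\tfrac12(\hat\mu_{\mathcal{J}}+\hat\mu_{\mathcal{J}^c}).$$ *Claim.* There is $C_0>0$, depending only on $a,b,c_{\min},c_{\max},K_X,K_\varepsilon,r,\kappa$, such that for every $C_1$ the following holds. If, for all large $m$, $C_0\sqrt{\log p/n}\le\lambda_\theta,\lambda_\beta\le C_1\sqrt{\log p/n}$, and if $\|\beta_{(1)}\|_0=o(\sqrt n/\log p)$ and $\|\theta_{(1)}\|_0=o(n/\log p)$, then $$\sqrt n\,(\hat\mu_{(1)}-\mu_{(1)})=n^{-1/2}\sum_{i=1}^n\Big[W_i\varepsilon_{i,(1)}\,q(X_i'\theta_{(1)})+X_i'\beta_{(1)}-\mu_{(1)}\Big]+o_P(1).$$ -/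

import Mathlib

open MeasureTheory ProbabilityTheory Filter Topology Asymptotics

noncomputable section

namespace BalancedATE

/-! ### One observation -/

/-- One unit `(X, W, Y(·))`: covariates `X ∈ ℝᵖ`, treatment status `W` (`true` means treated,
`W = 1`) and the pair of potential outcomes, `Y(1)` at `true` and `Y(0)` at `false`. -/
abbrev Obs (p : ℕ) : Type := (Fin p → ℝ) × Bool × (Bool → ℝ)

variable {p : ℕ}

/-- The covariate vector `X`. -/
def covar (o : Obs p) : Fin p → ℝ := o.1

/-- The treatment status `W`. -/
def treat (o : Obs p) : Bool := o.2.1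

/-- The treatment indicator, a real number in `{0, 1}`. -/
def ind (w : Bool) : ℝ := if w then 1 else 0

/-- The potential outcome under treatment, `Y(1)`. -/
def outcomeTreated (o : Obs p) : ℝ := o.2.2 true

/-- The observed outcome `Y = Y(W)`. -/
def outcome (o : Obs p) : ℝ := o.2.2 o.2.1

/-- The part `(X, W)` of an observation. -/
def covarTreat (o : Obs p) : (Fin p → ℝ) × Bool := (covar o, treat o)

/-- The inner product `x' t` of `ℝᵖ`. -/
def dot (x t : Fin p → ℝ) : ℝ := ∑ j, x j * t j

/-- The norm `‖t‖₁`. -/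
def l1 (t : Fin p → ℝ) : ℝ := ∑ j, |t j|

/-- The number `‖t‖₀` of nonzero coordinates. -/
def l0 (t : Fin p → ℝ) : ℕ := Set.ncard {j | t j ≠ 0}

/-- `q(z) = 1 + exp(-z)`, the inverse of the logistic function. -/
def q (z : ℝ) : ℝ := 1 + Real.exp (-z)

/-- The outcome error `ε = Y(1) - X'β` of the treatment arm. -/
def resid (β : Fin p → ℝ) (o : Obs p) : ℝ := outcomeTreated o - dot (covar o) β

/-- The propensity error `v = W - e(X)`, where `e(x) = 1 / (1 + exp(-x'θ))`. -/
def propResid (θ : Fin p → ℝ) (o : Obs p) : ℝ := ind (treat o) - 1 / q (dot (covar o) θ)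

theorem measurable_covar : Measurable (covar : Obs p → Fin p → ℝ) := measurable_fst

/-! ### The population -/

/-- The σ-algebra generated by `X`. -/
@[reducible]
def sigmaX (p : ℕ) : MeasurableSpace (Obs p) := MeasurableSpace.comap covar inferInstance

theorem sigmaX_le : sigmaX p ≤ (inferInstance : MeasurableSpace (Obs p)) :=
  measurable_covar.comap_le

/-- `‖Z‖_ψ₂ ≤ K`, where `‖Z‖_ψ₂ = inf {K > 0 : E exp(Z² / K²) ≤ 2}` is the sub-Gaussian norm. -/
def Psi2NormLE {Ω : Type*} [MeasurableSpace Ω] (P : Measure Ω) (Z : Ω → ℝ) (K : ℝ) : Prop :=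
  0 < K ∧ ∫⁻ ω, ENNReal.ofReal (Real.exp ((Z ω / K) ^ 2)) ∂P ≤ 2

/-- The matrix `E[X X']`. -/
def gram (P : Measure (Obs p)) : Matrix (Fin p) (Fin p) ℝ :=
  Matrix.of fun j k => ∫ o, covar o j * covar o k ∂P

/-- `μ₍₁₎ = E Y(1)`. -/
def mu1 (P : Measure (Obs p)) : ℝ := ∫ o, outcomeTreated o ∂P

/-- The linear-logistic specification for the treatment arm: `E[Y(1) | X] = X'β`,
`P(W = 1 | X) = 1 / (1 + exp(-X'θ))`, and the errors `ε` and `v` are conditionally independent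
given `X` (which is implied by unconfoundedness). -/
structure LinearLogistic (P : Measure (Obs p)) [IsFiniteMeasure P] (β θ : Fin p → ℝ) : Prop where
  outcome_model : P[outcomeTreated | sigmaX p] =ᵐ[P] fun o => dot (covar o) β
  propensity_model :
    P[fun o => ind (treat o) | sigmaX p] =ᵐ[P] fun o => 1 / (1 + Real.exp (-dot (covar o) θ))
  unconfounded : CondIndepFun (sigmaX p) sigmaX_le (resid β) (propResid θ) P

/-- The covariates lie in the cube `[a, b]ᵖ`, almost surely. -/
def CovariatesIn (P : Measure (Obs p)) (a b : ℝ) : Prop :=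
  ∀ᵐ o ∂P, ∀ j, covar o j ∈ Set.Icc a b

/-- Eigenvalue assumption: all eigenvalues of `E[X X']` are in `[cmin, cmax]`. -/
def EigenvalueAssumption (P : Measure (Obs p)) (cmin cmax : ℝ) : Prop :=
  spectrum ℝ (gram P) ⊆ Set.Icc cmin cmax

/-- Model assumption: `X` has sub-Gaussian norm `sup {‖X'u‖_ψ₂ : ‖u‖₂ = 1}` at most `KX`,
and the error `ε` is sub-Gaussian with norm at most `Kε`. -/
structure ModelAssumption (P : Measure (Obs p)) (β : Fin p → ℝ) (KX Kε : ℝ) : Prop where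
  covar_subgaussian :
    ∀ u : Fin p → ℝ, ∑ j, u j ^ 2 = 1 → Psi2NormLE P (fun o => dot (covar o) u) KX
  resid_subgaussian : Psi2NormLE P (resid β) Kε

/-! ### The estimators

A training sample for the propensity score is a finite family of pairs `(X, W)`. -/

/-- `x` is a minimizer of `f` over `S`, provided that there is one. -/
def SelectsArgmin {E : Type*} (f : E → ℝ) (S : Set E) (x : E) : Prop :=
  (∃ y ∈ S, IsMinOn f S y) → x ∈ S ∧ IsMinOn f S x

section Estimators

variable {ι : Type*} [Fintype ι]

/-- The `ℓ₁`-penalized covariate-balancing loss. -/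
def propLoss (d : ι → (Fin p → ℝ) × Bool) (lam : ℝ) (t : Fin p → ℝ) : ℝ :=
  (1 / (Fintype.card ι : ℝ)) *
      ∑ i, ((1 - ind (d i).2) * dot (d i).1 t + ind (d i).2 * Real.exp (-dot (d i).1 t))
    + lam * l1 t

/-- The vectors that balance the covariates up to `lam` in sup norm. -/
def balancingSet (d : ι → (Fin p → ℝ) × Bool) (lam : ℝ) : Set (Fin p → ℝ) :=
  {t | ∀ j, |(1 / (Fintype.card ι : ℝ)) *
      ∑ i, (1 - ind (d i).2 * (1 + Real.exp (-dot (d i).1 t))) * (d i).1 j| ≤ lam}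

/-- `t` is an output of the optimistic penalized covariate-balancing algorithm on the training
sample `d`: first `tc` minimizes the penalized loss; if `‖tc‖₁ > κ` then `t` has the smallest
`ℓ₁`-norm in the balancing set, and otherwise `t = tc`. -/
def IsPropensityOutput (d : ι → (Fin p → ℝ) × Bool) (lam κ : ℝ) (t : Fin p → ℝ) : Prop :=
  ∃ tc : Fin p → ℝ, SelectsArgmin (propLoss d lam) Set.univ tc ∧
    (κ < l1 tc → SelectsArgmin l1 (balancingSet d lam) t) ∧
    (l1 tc ≤ κ → t = tc)

/-- The weighted lasso loss of the outcome regression, with propensity estimate `t`. -/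
def outcomeLoss (d : ι → Obs p) (t : Fin p → ℝ) (lam : ℝ) (b : Fin p → ℝ) : ℝ :=
  (1 / (Fintype.card ι : ℝ)) *
      ∑ i, ind (treat (d i)) * Real.exp (-dot (covar (d i)) t) *
        (outcome (d i) - dot (covar (d i)) b) ^ 2
    + lam * l1 b

/-- The mean estimate on the evaluation sample `d`, with propensity estimate `t` and outcome
estimate `b`. -/
def foldMean (d : ι → Obs p) (t b : Fin p → ℝ) : ℝ :=
  (1 / (Fintype.card ι : ℝ)) *
    ∑ i, (dot (covar (d i)) b +
      q (dot (covar (d i)) t) * ind (treat (d i)) * (outcome (d i) - dot (covar (d i)) b))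

end Estimators

section Sample

variable {n : ℕ}

/-- The subsample indexed by `F`. -/
def restrictTo (s : Fin n → Obs p) (F : Finset (Fin n)) : F → Obs p := fun i => s i

/-- The pairs `(X, W)` of the subsample indexed by `F`. -/
def propSample (s : Fin n → Obs p) (F : Finset (Fin n)) : F → (Fin p → ℝ) × Bool :=
  fun i => covarTreat (s i)

/-- A propensity estimator trained on `F`: a measurable function of `(Xᵢ, Wᵢ)`, `i ∈ F`, whose
values are outputs of the algorithm. -/
def IsPropensityEstimator (F : Finset (Fin n)) (lam κ : ℝ)
    (T : (F → (Fin p → ℝ) × Bool) → Fin p → ℝ) : Prop :=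
  Measurable T ∧ ∀ d, IsPropensityOutput d lam κ (T d)

/-- The cross-fitted estimate `(μ̂_J + μ̂_{Jᶜ}) / 2`: on each half the propensity estimate comes from
that half, and the outcome estimate from the other half. -/
def muHat (s : Fin n → Obs p) (J : Finset (Fin n)) (tJ tJc bJ bJc : Fin p → ℝ) : ℝ :=
  (foldMean (restrictTo s J) tJ bJc + foldMean (restrictTo s Jᶜ) tJc bJ) / 2

/-- `n^{-1/2} ∑ᵢ [Wᵢ εᵢ q(Xᵢ'θ) + Xᵢ'β - μ₍₁₎]`. -/
def linearTerm (P : Measure (Obs p)) (β θ : Fin p → ℝ) (s : Fin n → Obs p) : ℝ :=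
  (1 / Real.sqrt n) *
    ∑ i, (ind (treat (s i)) * resid β (s i) * q (dot (covar (s i)) θ)
      + (dot (covar (s i)) β - mu1 P))

end Sample

/-- `Z m = o_P(1)`, where `Z m` lives on a probability space that may change with `m`. -/
def IsLittleOP {Ω : ℕ → Type*} [∀ m, MeasurableSpace (Ω m)] (P : ∀ m, Measure (Ω m))
    (Z : ∀ m, Ω m → ℝ) : Prop :=
  ∀ δ : ℝ, 0 < δ → Tendsto (fun m => P m {ω | δ ≤ |Z m ω|}) atTop (𝓝 0)

/-- The rate `√(log p / n)` of the tuning parameters. -/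
def tuningRate (n p : ℕ) : ℝ := Real.sqrt (Real.log p / n)

end BalancedATE

end

/-!
The error of the cross-fitted estimate has an exact expansion. On a fold `F` with propensity
estimate `t`, and with the outcome estimate `b` of the other fold, `foldMean_eq` gives

  `μ̂_F = mean_F [W ε q(X'θ) + X'β] + mean_F [W (e^{-X't} - e^{-X'θ}) ε] + balance_F(t)'(b - β)`,

so it suffices that the last two terms are `o_P(n^{-1/2})`.

*Third term.* It is at most `‖balance_F(t)‖_∞ ‖b - β‖₁`. When the true weights balance the
covariates up to `λ/2`, which holds with high probability, both branches of the propensity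
algorithm have minimizers and output a `t` with `‖balance_F(t)‖_∞ ≤ λ` and `‖t‖₁ ≤ κ`
(`IsPropensityOutput.spec`). The weighted lasso satisfies `‖b - β‖₁ ≲ s λ`
(`lasso_l1_error_le`). As `s = o(√n / log p)`, the product is of order `s log p / n = o(n^{-1/2})`.
Ultra-sparsity also makes the restricted eigenvalue condition cheap: the entries of the Gram matrix
of the treated units concentrate at rate `√(log p / n)`, and `s √(log p / n) → 0`.

*Second term.* Two vectors of bounded `ℓ₁`-norm that both balance the covariates up to `λ` give
weights whose mean squared difference on the treated units is `O(λ)`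
(`sum_treated_sq_exp_sub_le`), by monotonicity of the gradient and without any eigenvalue
condition. As `λ → 0` unless `θ = 0`, in which case `t = 0` exactly, the weights in the second term
are small in mean square, and they depend on `(X, W)` only.

*Noise with data-dependent weights.* Conditional independence of the errors gives `E[ε | X, W] = 0`
(`condExp_resid_covarTreat`). The conditional law of `ε` is not uniformly sub-Gaussian, since only
its unconditional `ψ₂`-norm is bounded. The substitute is `lintegral_exp_sum_mul_le`: for weights
`g_i` that are functions of all the pairs `(X, W)`, replacing one coordinate at a time in the
inequality `e^x ≤ x + e^{x²}` gives `E exp(∑ g_i ε_i) ≤ E exp(∑ g_i² ε_i²)`. Bounding `g_i` on the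
right-hand side removes the dependence on the weights. Its quadratic analogue
`lintegral_sq_sum_mul_le` serves for the second term.

The sparsity assumptions do not relate `p` and `n` when both `β = 0` and `θ = 0`. If `log p`
exceeds a multiple of `n`, the tuning parameters exceed a constant that dominates the noise by a
crude bound, so that the zero vector is recovered exactly.
-/

noncomputable section

namespace BalancedATE

/-! ### Decoupling of weights and errors -/

section Decoupling

variable {Ω : Type*} {m mΩ : MeasurableSpace Ω} {P : Measure Ω} {ε : Ω → ℝ}

theorem integral_mul_eq_zero_of_condExp_eq_zero (hm : m ≤ mΩ)
    [IsFiniteMeasure P] (hε : Integrable ε P) (h0 : P[ε | m] =ᵐ[P] 0) {l : Ω → ℝ}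
    (hl : Measurable[m] l) {c : ℝ} (hc : ∀ᵐ o ∂P, |l o| ≤ c) : ∫ o, l o * ε o ∂P = 0 := by
  have h1 : P[l * ε | m] =ᵐ[P] l * P[ε | m] :=
    condExp_stronglyMeasurable_mul_of_bound hm hl.stronglyMeasurable hε c
      hc
  have h2 : ∫ o, (P[l * ε | m]) o ∂P = ∫ o, (l * ε) o ∂P := integral_condExp hm
  rw [show (∫ o, l o * ε o ∂P) = ∫ o, (l * ε) o ∂P from rfl, ← h2, integral_congr_ae h1]
  refine integral_eq_zero_of_ae ?_
  filter_upwards [h0] with o ho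
  simp [ho]

/-- An error with conditional mean zero may be dropped from a pointwise bound, even when the product
`l * ε` is not integrable: truncate `l` and let the level grow. -/
theorem lintegral_le_of_le_mul_add (hm : m ≤ mΩ)
    [IsFiniteMeasure P] (hε : Integrable ε P) (h0 : P[ε | m] =ᵐ[P] 0) {l Φ Ψ : Ω → ℝ}
    (hl : Measurable[m] l) (hΨm : Measurable Ψ) (hΦ : ∀ o, 0 ≤ Φ o)
    (hΨ : ∀ o, 0 ≤ Ψ o) (h : ∀ o, Φ o ≤ l o * ε o + Ψ o) :
    ∫⁻ o, ENNReal.ofReal (Φ o) ∂P ≤ ∫⁻ o, ENNReal.ofReal (Ψ o) ∂P := by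
  set T : ℕ → Set Ω := fun k => {o | |l o| ≤ k} with hT
  have hTm' : ∀ k, MeasurableSet[m] (T k) := fun k =>
    (measurable_norm.comp hl) measurableSet_Iic
  have hTm : ∀ k, MeasurableSet (T k) := fun k => hm _ (hTm' k)
  have hTmono : Monotone T := fun j k hjk o (ho : |l o| ≤ j) =>
    show |l o| ≤ k from ho.trans (by exact_mod_cast hjk)
  have hTU : ⋃ k, T k = Set.univ := by
    ext o
    simp only [Set.mem_iUnion, Set.mem_univ, iff_true]
    exact exists_nat_ge |l o|
  rw [← setLIntegral_univ, ← hTU, setLIntegral_iUnion_of_directed _ (hTmono.directed_le)]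
  refine iSup_le fun k => le_trans ?_ (setLIntegral_le_lintegral (T k) _)
  by_cases hfin : ∫⁻ o in T k, ENNReal.ofReal (Ψ o) ∂P = ⊤
  · rw [hfin]; exact le_top
  have hΨi : Integrable Ψ (P.restrict (T k)) :=
    (lintegral_ofReal_ne_top_iff_integrable hΨm.aestronglyMeasurable
      (Eventually.of_forall hΨ)).1 hfin
  have hli : Integrable (fun o => l o * ε o) (P.restrict (T k)) := by
    refine (hε.restrict (s := T k)).bdd_mul (c := k) (hl.mono hm le_rfl).aestronglyMeasurable ?_
    filter_upwards [ae_restrict_mem (hTm k)] with o ho using ho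
  have hzero : ∫ o in T k, l o * ε o ∂P = 0 := by
    have := integral_mul_eq_zero_of_condExp_eq_zero hm hε h0
      (l := (T k).indicator l) (hl.indicator (hTm' k)) (c := k) (Eventually.of_forall fun o => by
        by_cases ho : o ∈ T k
        · rw [Set.indicator_of_mem ho]; exact ho
        · simp [ho])
    rw [← integral_indicator (hTm k), ← this]
    congr 1
    ext o
    by_cases ho : o ∈ T k <;> simp [ho]
  calc ∫⁻ o in T k, ENNReal.ofReal (Φ o) ∂P
      ≤ ∫⁻ o in T k, ENNReal.ofReal (l o * ε o + Ψ o) ∂P :=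
        lintegral_mono fun o => ENNReal.ofReal_le_ofReal (h o)
    _ = ENNReal.ofReal (∫ o in T k, (l o * ε o + Ψ o) ∂P) :=
        (ofReal_integral_eq_lintegral_ofReal (hli.add hΨi)
          (Eventually.of_forall fun o => (hΦ o).trans (h o))).symm
    _ = ENNReal.ofReal (∫ o in T k, Ψ o ∂P) := by
        rw [integral_add hli hΨi, hzero, zero_add]
    _ = ∫⁻ o in T k, ENNReal.ofReal (Ψ o) ∂P :=
        ofReal_integral_eq_lintegral_ofReal hΨi (Eventually.of_forall hΨ)

variable {ι : Type*} [Fintype ι] [DecidableEq ι]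

/-- The same for one coordinate `s i` of an i.i.d. sample. Measurability of `l` asks that, with the
other coordinates fixed, `l` depends on `s i` only through the information `m`. -/
theorem lintegral_pi_le_of_le_mul_add (hm : m ≤ mΩ)
    [IsProbabilityMeasure P] (hε : Integrable ε P) (h0 : P[ε | m] =ᵐ[P] 0) (i : ι)
    {l Φ Ψ : (ι → Ω) → ℝ} (hl : ∀ s, Measurable[m] fun o => l (Function.update s i o))
    (hΦm : Measurable Φ) (hΨm : Measurable Ψ) (hΦ : ∀ s, 0 ≤ Φ s) (hΨ : ∀ s, 0 ≤ Ψ s)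
    (h : ∀ s, Φ s ≤ l s * ε (s i) + Ψ s) :
    ∫⁻ s, ENNReal.ofReal (Φ s) ∂(Measure.pi fun _ : ι => P)
      ≤ ∫⁻ s, ENNReal.ofReal (Ψ s) ∂(Measure.pi fun _ : ι => P) := by
  refine lintegral_le_of_lmarginal_le {i} hΦm.ennreal_ofReal hΨm.ennreal_ofReal ?_
  rw [lmarginal_singleton, lmarginal_singleton]
  intro s
  refine lintegral_le_of_le_mul_add hm hε h0 (hl s) (hΨm.comp (measurable_update s))
    (fun o => hΦ _) (fun o => hΨ _) fun o => ?_
  simpa using h (Function.update s i o)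

theorem exp_le_add_exp_sq (x : ℝ) : Real.exp x ≤ x + Real.exp (x ^ 2) := by
  rcases le_or_gt |x| 1 with h | h
  · have h1 := (abs_le.1 (Real.abs_exp_sub_one_sub_id_le h)).2
    have h2 := Real.add_one_le_exp (x ^ 2)
    linarith
  · rcases le_or_gt 0 x with h0 | h0
    · rw [abs_of_nonneg h0] at h
      have : Real.exp x ≤ Real.exp (x ^ 2) := Real.exp_le_exp.2 (by nlinarith)
      linarith
    · rw [abs_of_neg h0] at h
      have h1 := Real.exp_le_one_iff.2 h0.le
      have h2 := Real.add_one_le_exp (x ^ 2)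
      nlinarith

/-- Weights that depend on the conditioning information of the whole sample decouple from the
errors. The right-hand side can be bounded through a bound for the weights alone. -/
theorem lintegral_exp_sum_mul_le (hm : m ≤ mΩ)
    [IsProbabilityMeasure P] (hεm : Measurable ε) (hε : Integrable ε P) (h0 : P[ε | m] =ᵐ[P] 0)
    {g : ι → (ι → Ω) → ℝ} (hgm : ∀ i, Measurable (g i))
    (hg : ∀ i k s, Measurable[m] fun o => g k (Function.update s i o)) :
    ∫⁻ s, ENNReal.ofReal (Real.exp (∑ i, g i s * ε (s i))) ∂(Measure.pi fun _ : ι => P)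
      ≤ ∫⁻ s, ENNReal.ofReal (Real.exp (∑ i, (g i s * ε (s i)) ^ 2))
          ∂(Measure.pi fun _ : ι => P) := by
  -- the coordinates in `S` have been replaced
  have key : ∀ S : Finset ι,
      ∫⁻ s, ENNReal.ofReal (Real.exp (∑ i, g i s * ε (s i))) ∂(Measure.pi fun _ : ι => P)
      ≤ ∫⁻ s, ENNReal.ofReal (Real.exp (∑ i ∈ S, (g i s * ε (s i)) ^ 2
          + ∑ i ∈ Sᶜ, g i s * ε (s i))) ∂(Measure.pi fun _ : ι => P) := by
    intro S
    induction S using Finset.induction_on with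
    | empty => simp
    | insert i S hi ih =>
      refine ih.trans (lintegral_pi_le_of_le_mul_add hm hε h0 i
        (l := fun s => Real.exp (∑ k ∈ S, (g k s * ε (s k)) ^ 2
          + ∑ k ∈ (insert i S)ᶜ, g k s * ε (s k)) * g i s) ?_ ?_ ?_
        (fun s => (Real.exp_pos _).le) (fun s => (Real.exp_pos _).le) ?_)
      · intro s
        have e1 : ∀ o, ∑ k ∈ S, (g k (Function.update s i o) * ε (Function.update s i o k)) ^ 2
            = ∑ k ∈ S, (g k (Function.update s i o) * ε (s k)) ^ 2 := fun o =>
          Finset.sum_congr rfl fun k hk => by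
            rw [Function.update_of_ne (by rintro rfl; exact hi hk)]
        have e2 : ∀ o, ∑ k ∈ (insert i S)ᶜ, g k (Function.update s i o)
              * ε (Function.update s i o k)
            = ∑ k ∈ (insert i S)ᶜ, g k (Function.update s i o) * ε (s k) := fun o =>
          Finset.sum_congr rfl fun k hk => by
            rw [Function.update_of_ne (by rintro rfl; simp at hk)]
        simp only [e1, e2]
        exact (Real.measurable_exp.comp
          ((Finset.measurable_fun_sum _ fun k _ => ((hg i k s).mul_const _).pow_const 2).add
            (Finset.measurable_fun_sum _ fun k _ => (hg i k s).mul_const _))).mul (hg i i s)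
      · fun_prop
      · fun_prop
      · intro s
        have hc : Sᶜ = insert i (insert i S)ᶜ := by
          ext k; by_cases hk : k = i <;> simp [hk, hi]
        rw [hc, Finset.sum_insert (by simp), Finset.sum_insert hi]
        set A := ∑ k ∈ S, (g k s * ε (s k)) ^ 2
        set D := ∑ k ∈ (insert i S)ᶜ, g k s * ε (s k)
        rw [show A + (g i s * ε (s i) + D) = (A + D) + g i s * ε (s i) by ring,
          show (g i s * ε (s i)) ^ 2 + A + D = (A + D) + (g i s * ε (s i)) ^ 2 by ring,
          Real.exp_add, Real.exp_add (A + D)]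
        have := mul_le_mul_of_nonneg_left (exp_le_add_exp_sq (g i s * ε (s i)))
          (Real.exp_pos (A + D)).le
        linarith
  simpa using key Finset.univ

/-- Errors with conditional mean zero are orthogonal, also after multiplication by such weights. -/
theorem lintegral_sq_sum_mul_le (hm : m ≤ mΩ)
    [IsProbabilityMeasure P] (hεm : Measurable ε) (hε : Integrable ε P) (h0 : P[ε | m] =ᵐ[P] 0)
    {g : ι → (ι → Ω) → ℝ} (hgm : ∀ i, Measurable (g i))
    (hg : ∀ i k s, Measurable[m] fun o => g k (Function.update s i o)) :
    ∫⁻ s, ENNReal.ofReal ((∑ i, g i s * ε (s i)) ^ 2) ∂(Measure.pi fun _ : ι => P)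
      ≤ ∫⁻ s, ENNReal.ofReal (∑ i, (g i s * ε (s i)) ^ 2)
          ∂(Measure.pi fun _ : ι => P) := by
  have key : ∀ S : Finset ι,
      ∫⁻ s, ENNReal.ofReal ((∑ i, g i s * ε (s i)) ^ 2) ∂(Measure.pi fun _ : ι => P)
      ≤ ∫⁻ s, ENNReal.ofReal (∑ i ∈ S, (g i s * ε (s i)) ^ 2
          + (∑ i ∈ Sᶜ, g i s * ε (s i)) ^ 2) ∂(Measure.pi fun _ : ι => P) := by
    intro S
    induction S using Finset.induction_on with
    | empty => simp
    | insert i S hi ih =>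
      refine ih.trans (lintegral_pi_le_of_le_mul_add hm hε h0 i
        (l := fun s => 2 * (∑ k ∈ (insert i S)ᶜ, g k s * ε (s k)) * g i s) ?_ ?_ ?_
        (fun s => by positivity) (fun s => by positivity) ?_)
      · intro s
        have e2 : ∀ o, ∑ k ∈ (insert i S)ᶜ, g k (Function.update s i o)
              * ε (Function.update s i o k)
            = ∑ k ∈ (insert i S)ᶜ, g k (Function.update s i o) * ε (s k) := fun o =>
          Finset.sum_congr rfl fun k hk => by
            rw [Function.update_of_ne (by rintro rfl; simp at hk)]
        simp only [e2]
        exact ((Finset.measurable_fun_sum _ fun k _ => (hg i k s).mul_const _).const_mul 2).mul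
          (hg i i s)
      · fun_prop
      · fun_prop
      · intro s
        have hc : Sᶜ = insert i (insert i S)ᶜ := by
          ext k; by_cases hk : k = i <;> simp [hk, hi]
        rw [hc, Finset.sum_insert (by simp), Finset.sum_insert hi]
        apply le_of_eq
        ring
  simpa using key Finset.univ

end Decoupling

/-! ### Sub-Gaussian errors -/

section SubGaussian

variable {Ω : Type*} {m mΩ : MeasurableSpace Ω} {P : Measure Ω} {ε : Ω → ℝ} {K : ℝ}

/-- Interpolation of the `ψ₂`-bound to smaller exponents, by convexity of the exponential. -/
theorem Psi2NormLE.lintegral_exp_le [IsProbabilityMeasure P] (h : Psi2NormLE P ε K)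
    {α : ℝ} (h0 : 0 ≤ α) (h1 : α ≤ 1) :
    ∫⁻ o, ENNReal.ofReal (Real.exp (α * (ε o / K) ^ 2)) ∂P ≤ ENNReal.ofReal (Real.exp α) := by
  have hpt : ∀ o, ENNReal.ofReal (Real.exp (α * (ε o / K) ^ 2))
      ≤ ENNReal.ofReal (1 - α)
        + ENNReal.ofReal α * ENNReal.ofReal (Real.exp ((ε o / K) ^ 2)) := by
    intro o
    rw [← ENNReal.ofReal_mul h0, ← ENNReal.ofReal_add (by linarith) (by positivity)]
    refine ENNReal.ofReal_le_ofReal ?_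
    have := convexOn_exp.2 (Set.mem_univ (0 : ℝ)) (Set.mem_univ ((ε o / K) ^ 2))
      (sub_nonneg.2 h1) h0 (by ring)
    simpa using this
  calc _ ≤ ∫⁻ o, (ENNReal.ofReal (1 - α)
        + ENNReal.ofReal α * ENNReal.ofReal (Real.exp ((ε o / K) ^ 2))) ∂P := lintegral_mono hpt
    _ = ENNReal.ofReal (1 - α)
        + ENNReal.ofReal α * ∫⁻ o, ENNReal.ofReal (Real.exp ((ε o / K) ^ 2)) ∂P := by
        rw [lintegral_add_left measurable_const, lintegral_const_mul' _ _ ENNReal.ofReal_ne_top]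
        simp
    _ ≤ ENNReal.ofReal (1 - α) + ENNReal.ofReal α * 2 := by gcongr; exact h.2
    _ = ENNReal.ofReal (α + 1) := by
        rw [show (2 : ENNReal) = ENNReal.ofReal 2 by simp, ← ENNReal.ofReal_mul h0,
          ← ENNReal.ofReal_add (by linarith) (by positivity)]
        congr 1; ring
    _ ≤ _ := ENNReal.ofReal_le_ofReal (Real.add_one_le_exp α)

theorem psi2NormLE_of_abs_le [IsProbabilityMeasure P] {c : ℝ} (hc : 0 < c)
    (h : ∀ᵐ o ∂P, |ε o| ≤ c) : Psi2NormLE P ε (2 * c) := by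
  refine ⟨by positivity, ?_⟩
  calc _ ≤ ∫⁻ _, 2 ∂P := by
        refine lintegral_mono_ae ?_
        filter_upwards [h] with o ho
        rw [show (2 : ENNReal) = ENNReal.ofReal 2 by simp]
        refine ENNReal.ofReal_le_ofReal ?_
        have h1 : (ε o / (2 * c)) ^ 2 ≤ 1 / 4 := by
          rw [div_pow, div_le_iff₀ (by positivity)]
          have := sq_le_sq' (by linarith [(abs_le.1 ho).1]) (abs_le.1 ho).2
          linarith
        calc Real.exp ((ε o / (2 * c)) ^ 2) ≤ Real.exp (1 / 4) := Real.exp_le_exp.2 h1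
          _ ≤ 2 := by
            have h2 : (1 / 4 : ℝ) ≤ Real.log 2 := by
              have := Real.log_two_gt_d9; linarith
            calc Real.exp (1 / 4) ≤ Real.exp (Real.log 2) := Real.exp_le_exp.2 h2
              _ = 2 := Real.exp_log (by norm_num)
    _ = 2 := by simp

theorem Psi2NormLE.lintegral_pow_four_le (h : Psi2NormLE P ε K) :
    ∫⁻ o, ENNReal.ofReal (ε o ^ 4) ∂P ≤ ENNReal.ofReal (4 * K ^ 4) := by
  have hK := h.1
  calc _ ≤ ∫⁻ o, ENNReal.ofReal (2 * K ^ 4) * ENNReal.ofReal (Real.exp ((ε o / K) ^ 2)) ∂P := by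
        refine lintegral_mono fun o => ?_
        rw [← ENNReal.ofReal_mul (by positivity)]
        refine ENNReal.ofReal_le_ofReal ?_
        have h1 := Real.quadratic_le_exp_of_nonneg (sq_nonneg (ε o / K))
        have h2 : ε o ^ 4 = K ^ 4 * ((ε o / K) ^ 2) ^ 2 := by field_simp
        rw [h2]
        have h3 : ((ε o / K) ^ 2) ^ 2 ≤ 2 * Real.exp ((ε o / K) ^ 2) := by
          nlinarith [sq_nonneg (ε o / K)]
        calc _ ≤ K ^ 4 * (2 * Real.exp ((ε o / K) ^ 2)) := by gcongr
          _ = _ := by ring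
    _ = ENNReal.ofReal (2 * K ^ 4) * ∫⁻ o, ENNReal.ofReal (Real.exp ((ε o / K) ^ 2)) ∂P :=
        lintegral_const_mul' _ _ ENNReal.ofReal_ne_top
    _ ≤ ENNReal.ofReal (2 * K ^ 4) * 2 := by gcongr; exact h.2
    _ = _ := by
        rw [show (2 : ENNReal) = ENNReal.ofReal 2 by simp, ← ENNReal.ofReal_mul (by positivity)]
        congr 1; ring

theorem Psi2NormLE.integrable [IsFiniteMeasure P] (h : Psi2NormLE P ε K)
    (hm : Measurable ε) : Integrable ε P := by
  have h4 : Integrable (fun o => ε o ^ 4) P :=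
    (lintegral_ofReal_ne_top_iff_integrable (by fun_prop)
      (Eventually.of_forall fun o => by positivity)).1
      (ne_top_of_le_ne_top ENNReal.ofReal_ne_top h.lintegral_pow_four_le)
  refine (h4.add (integrable_const 1)).mono' hm.aestronglyMeasurable
    (Eventually.of_forall fun o => ?_)
  simp only [Real.norm_eq_abs, Pi.add_apply]
  have : ε o ^ 4 = |ε o| ^ 4 := (Even.pow_abs (by decide) _).symm
  rw [this]
  nlinarith [sq_nonneg (|ε o| ^ 2 - 1), sq_nonneg (|ε o| - 1), sq_nonneg (|ε o|)]

variable {ι : Type*} [Fintype ι]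

theorem lintegral_pi_exp_sum_sq [IsProbabilityMeasure P] (hε : Measurable ε) (u : ℝ) :
    ∫⁻ s, ENNReal.ofReal (Real.exp (∑ i, u * (ε (s i) / K) ^ 2)) ∂(Measure.pi fun _ : ι => P)
      = (∫⁻ o, ENNReal.ofReal (Real.exp (u * (ε o / K) ^ 2)) ∂P) ^ Fintype.card ι := by
  have hf : Measurable fun o => ENNReal.ofReal (Real.exp (u * (ε o / K) ^ 2)) := by fun_prop
  have hind := iIndepFun_pi (μ := fun _ : ι => P)
    (X := fun _ => fun o => ENNReal.ofReal (Real.exp (u * (ε o / K) ^ 2)))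
    fun _ => hf.aemeasurable
  have := lintegral_prod_eq_prod_lintegral_of_indepFun Finset.univ _ hind
    fun i => hf.comp (measurable_pi_apply i)
  calc _ = ∫⁻ s, ∏ i, ENNReal.ofReal (Real.exp (u * (ε (s i) / K) ^ 2))
        ∂(Measure.pi fun _ : ι => P) := by
        refine lintegral_congr fun s => ?_
        rw [Real.exp_sum, ENNReal.ofReal_prod_of_nonneg fun _ _ => (Real.exp_pos _).le]
    _ = ∏ i : ι, ∫⁻ s, ENNReal.ofReal (Real.exp (u * (ε (s i) / K) ^ 2))
        ∂(Measure.pi fun _ : ι => P) := this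
    _ = ∏ _i : ι, ∫⁻ o, ENNReal.ofReal (Real.exp (u * (ε o / K) ^ 2)) ∂P :=
        Finset.prod_congr rfl fun i _ =>
          (measurePreserving_eval (fun _ : ι => P) i).lintegral_comp hf
    _ = _ := by simp

theorem measure_ge_le_of_lintegral_exp {Ω' : Type*} [MeasurableSpace Ω'] {Q : Measure Ω'}
    {S : Ω' → ℝ} (hS : Measurable S) {u v : ℝ}
    (h : ∫⁻ s, ENNReal.ofReal (Real.exp (S s)) ∂Q ≤ ENNReal.ofReal (Real.exp v)) :
    Q {s | u ≤ S s} ≤ ENNReal.ofReal (Real.exp (v - u)) := by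
  have h1 := mul_meas_ge_le_lintegral (μ := Q)
    (f := fun s => ENNReal.ofReal (Real.exp (S s))) (by fun_prop) (ENNReal.ofReal (Real.exp u))
  have h2 : {s | ENNReal.ofReal (Real.exp u) ≤ ENNReal.ofReal (Real.exp (S s))}
      = {s | u ≤ S s} := by
    ext s
    simp [ENNReal.ofReal_le_ofReal_iff (Real.exp_pos _).le]
  rw [h2] at h1
  have h3 := h1.trans h
  have hne : ENNReal.ofReal (Real.exp u) ≠ 0 := by simp [Real.exp_pos]
  rw [Real.exp_sub, ENNReal.ofReal_div_of_pos (Real.exp_pos _),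
    ENNReal.le_div_iff_mul_le (Or.inl hne) (Or.inl ENNReal.ofReal_ne_top), mul_comm]
  exact h3

/-- The empirical second moment exceeds `2 K²` with exponentially small probability. -/
theorem measure_pi_sum_sq_ge_le [IsProbabilityMeasure P] (hε : Measurable ε)
    (h : Psi2NormLE P ε K) :
    (Measure.pi fun _ : ι => P) {s | 2 * (Fintype.card ι : ℝ) ≤ ∑ i, (ε (s i) / K) ^ 2}
      ≤ ENNReal.ofReal (Real.exp (-(1 / 4) * (Fintype.card ι : ℝ))) := by
  have hlog : Real.log 2 ≤ 7 / 4 := by have := Real.log_two_lt_d9; linarith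
  refine (measure_ge_le_of_lintegral_exp (v := Fintype.card ι * Real.log 2) (by fun_prop)
    ?_).trans (ENNReal.ofReal_le_ofReal (Real.exp_le_exp.2 ?_))
  · have h1 := lintegral_pi_exp_sum_sq (ι := ι) (P := P) (K := K) hε 1
    simp only [one_mul] at h1
    rw [h1, Real.exp_nat_mul, Real.exp_log (by norm_num), ENNReal.ofReal_pow (by norm_num)]
    gcongr
    simpa using h.2
  · nlinarith [(Nat.cast_nonneg (Fintype.card ι) : (0 : ℝ) ≤ _)]

variable [DecidableEq ι]

/-- Chernoff bound for weighted errors at the level `2 c K ρ`. The restriction `ρ ≤ 1` keeps the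
exponent `(t g ε)²`, with `t = ρ / (c K)`, in the range where the `ψ₂`-bound applies. -/
theorem measure_pi_sum_mul_ge_le (hm : m ≤ mΩ) [IsProbabilityMeasure P] (hεm : Measurable ε)
    (h : Psi2NormLE P ε K) (h0 : P[ε | m] =ᵐ[P] 0)
    {g : ι → (ι → Ω) → ℝ} (hgm : ∀ i, Measurable (g i))
    (hg : ∀ i k s, Measurable[m] fun o => g k (Function.update s i o))
    {c : ℝ} (hc : 0 < c) (hgc : ∀ i s, |g i s| ≤ c) {ρ : ℝ} (hρ0 : 0 ≤ ρ) (hρ1 : ρ ≤ 1) :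
    (Measure.pi fun _ : ι => P)
        {s | (Fintype.card ι : ℝ) * (2 * c * K * ρ) ≤ ∑ i, g i s * ε (s i)}
      ≤ ENNReal.ofReal (Real.exp (-(Fintype.card ι : ℝ) * ρ ^ 2)) := by
  have hK := h.1
  set N : ℝ := (Fintype.card ι : ℝ) with hN
  set t : ℝ := ρ / (c * K) with ht
  have ht0 : 0 ≤ t := by positivity
  have hsub : {s : ι → Ω | N * (2 * c * K * ρ) ≤ ∑ i, g i s * ε (s i)}
      ⊆ {s | 2 * N * ρ ^ 2 ≤ ∑ i, (t * g i s) * ε (s i)} := by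
    intro s (hs : N * (2 * c * K * ρ) ≤ ∑ i, g i s * ε (s i))
    show 2 * N * ρ ^ 2 ≤ ∑ i, (t * g i s) * ε (s i)
    have h2 := mul_le_mul_of_nonneg_left hs ht0
    have h3 : ∑ i, (t * g i s) * ε (s i) = t * ∑ i, g i s * ε (s i) := by
      rw [Finset.mul_sum]; exact Finset.sum_congr rfl fun _ _ => by ring
    rw [h3]
    refine le_trans (le_of_eq ?_) h2
    rw [ht]; field_simp
  refine (measure_mono hsub).trans ((measure_ge_le_of_lintegral_exp (v := N * ρ ^ 2) (by fun_prop)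
    ?_).trans (le_of_eq (by congr 2; ring)))
  refine (lintegral_exp_sum_mul_le hm hεm (h.integrable hεm) h0 (g := fun i s => t * g i s)
    (fun i => by fun_prop) (fun i k s => (hg i k s).const_mul t)).trans ?_
  calc _ ≤ ∫⁻ s, ENNReal.ofReal (Real.exp (∑ i, ρ ^ 2 * (ε (s i) / K) ^ 2))
        ∂(Measure.pi fun _ : ι => P) := by
        refine lintegral_mono fun s => ENNReal.ofReal_le_ofReal (Real.exp_le_exp.2
          (Finset.sum_le_sum fun i _ => ?_))
        have h4 : g i s ^ 2 ≤ c ^ 2 := sq_le_sq' (abs_le.1 (hgc i s)).1 (abs_le.1 (hgc i s)).2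
        calc (t * g i s * ε (s i)) ^ 2 = (t * ε (s i)) ^ 2 * g i s ^ 2 := by ring
          _ ≤ (t * ε (s i)) ^ 2 * c ^ 2 := by gcongr
          _ = ρ ^ 2 * (ε (s i) / K) ^ 2 := by rw [ht]; field_simp
    _ = _ := lintegral_pi_exp_sum_sq hεm _
    _ ≤ (ENNReal.ofReal (Real.exp (ρ ^ 2))) ^ Fintype.card ι := by
        gcongr
        exact h.lintegral_exp_le (by positivity) (by nlinarith)
    _ = _ := by rw [← ENNReal.ofReal_pow (Real.exp_pos _).le, ← Real.exp_nat_mul]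

theorem measure_pi_abs_sum_mul_ge_le (hm : m ≤ mΩ) [IsProbabilityMeasure P] (hεm : Measurable ε)
    (h : Psi2NormLE P ε K) (h0 : P[ε | m] =ᵐ[P] 0)
    {g : ι → (ι → Ω) → ℝ} (hgm : ∀ i, Measurable (g i))
    (hg : ∀ i k s, Measurable[m] fun o => g k (Function.update s i o))
    {c : ℝ} (hc : 0 < c) (hgc : ∀ i s, |g i s| ≤ c) {ρ : ℝ} (hρ0 : 0 ≤ ρ) (hρ1 : ρ ≤ 1) :
    (Measure.pi fun _ : ι => P)
        {s | (Fintype.card ι : ℝ) * (2 * c * K * ρ) ≤ |∑ i, g i s * ε (s i)|}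
      ≤ 2 * ENNReal.ofReal (Real.exp (-(Fintype.card ι : ℝ) * ρ ^ 2)) := by
  have h1 := measure_pi_sum_mul_ge_le hm hεm h h0 hgm hg hc hgc hρ0 hρ1
  have h2 := measure_pi_sum_mul_ge_le hm hεm h h0 (g := fun i s => -g i s)
    (fun i => (hgm i).neg) (fun i k s => (hg i k s).neg) hc (fun i s => by simpa using hgc i s)
    hρ0 hρ1
  refine (measure_mono ?_).trans ((measure_union_le _ _).trans
    ((add_le_add h1 h2).trans (two_mul _).ge))
  intro s (hs : (Fintype.card ι : ℝ) * (2 * c * K * ρ) ≤ |∑ i, g i s * ε (s i)|)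
  rcases le_abs.1 hs with h | h
  · exact Or.inl h
  · refine Or.inr ?_
    simpa using h

theorem measure_pi_exists_abs_sum_mul_ge_le {A : Type*} [Fintype A] (hm : m ≤ mΩ)
    [IsProbabilityMeasure P] {f : A → Ω → ℝ} (hfm : ∀ a, Measurable (f a))
    (h : ∀ a, Psi2NormLE P (f a) K) (h0 : ∀ a, P[f a | m] =ᵐ[P] 0)
    {g : A → ι → (ι → Ω) → ℝ} (hgm : ∀ a i, Measurable (g a i))
    (hg : ∀ a i k s, Measurable[m] fun o => g a k (Function.update s i o))
    {c : ℝ} (hc : 0 < c) (hgc : ∀ a i s, |g a i s| ≤ c) {ρ : ℝ} (hρ0 : 0 ≤ ρ) (hρ1 : ρ ≤ 1) :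
    (Measure.pi fun _ : ι => P)
        {s | ∃ a, (Fintype.card ι : ℝ) * (2 * c * K * ρ) ≤ |∑ i, g a i s * f a (s i)|}
      ≤ Fintype.card A * (2 * ENNReal.ofReal (Real.exp (-(Fintype.card ι : ℝ) * ρ ^ 2))) := by
  have : {s : ι → Ω | ∃ a, (Fintype.card ι : ℝ) * (2 * c * K * ρ) ≤ |∑ i, g a i s * f a (s i)|}
      = ⋃ a, {s | (Fintype.card ι : ℝ) * (2 * c * K * ρ) ≤ |∑ i, g a i s * f a (s i)|} := by
    ext s; simp
  rw [this]
  refine (measure_iUnion_fintype_le _ _).trans ((Finset.sum_le_sum fun a _ =>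
    measure_pi_abs_sum_mul_ge_le hm (hfm a) (h a) (h0 a) (hgm a) (hg a) hc (hgc a) hρ0
      hρ1).trans ?_)
  simp

/-- Weights that are small in mean square make the normalized sum small, even though the
conditional variances of the errors are not bounded. -/
theorem measure_pi_abs_sum_mul_ge_sqrt_le (hm : m ≤ mΩ) [IsProbabilityMeasure P]
    (hεm : Measurable ε) (h : Psi2NormLE P ε K) (h0 : P[ε | m] =ᵐ[P] 0)
    {g : ι → (ι → Ω) → ℝ} (hgm : ∀ i, Measurable (g i))
    (hg : ∀ i k s, Measurable[m] fun o => g k (Function.update s i o))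
    {c η δ : ℝ} (hgc : ∀ i s, |g i s| ≤ c) (hη : 0 < η) (hδ : 0 < δ)
    (hgη : ∀ s, ∑ i, g i s ^ 2 ≤ Fintype.card ι * η) (hN : 0 < Fintype.card ι) :
    (Measure.pi fun _ : ι => P)
        {s | δ * Real.sqrt (Fintype.card ι) ≤ |∑ i, g i s * ε (s i)|}
      ≤ ENNReal.ofReal (Real.sqrt η * (c ^ 2 + 4 * K ^ 4) / δ ^ 2) := by
  have hN' : (0 : ℝ) < Fintype.card ι := by exact_mod_cast hN
  set N : ℝ := (Fintype.card ι : ℝ) with hNdef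
  set w := Real.sqrt η with hw
  have hw0 : 0 < w := Real.sqrt_pos.2 hη
  have hww : w * w = η := Real.mul_self_sqrt hη.le
  have hpt : ∀ s : ι → Ω, ∑ i, (g i s * ε (s i)) ^ 2
      ≤ N * (w * c ^ 2) + ∑ i, w * ε (s i) ^ 4 := by
    intro s
    have h1 : ∀ i, (g i s * ε (s i)) ^ 2 ≤ c ^ 2 / w * g i s ^ 2 + w * ε (s i) ^ 4 := by
      intro i
      have h4 : g i s ^ 2 ≤ c ^ 2 := sq_le_sq' (abs_le.1 (hgc i s)).1 (abs_le.1 (hgc i s)).2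
      have h5 : g i s ^ 2 * g i s ^ 2 / w ≤ c ^ 2 / w * g i s ^ 2 := by
        rw [div_mul_eq_mul_div]; gcongr
      refine le_trans ?_ (add_le_add_left h5 _)
      rw [← sub_nonneg]
      have h6 : g i s ^ 2 * g i s ^ 2 / w + w * ε (s i) ^ 4 - (g i s * ε (s i)) ^ 2
          = ((g i s ^ 2 - w * ε (s i) ^ 2 / 2) ^ 2 + 3 / 4 * (w * ε (s i) ^ 2) ^ 2) / w := by
        field_simp; ring
      rw [h6]; positivity
    calc _ ≤ ∑ i, (c ^ 2 / w * g i s ^ 2 + w * ε (s i) ^ 4) := Finset.sum_le_sum fun i _ => h1 i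
      _ = c ^ 2 / w * ∑ i, g i s ^ 2 + ∑ i, w * ε (s i) ^ 4 := by
          rw [Finset.sum_add_distrib, Finset.mul_sum]
      _ ≤ c ^ 2 / w * (N * η) + ∑ i, w * ε (s i) ^ 4 := by gcongr; exact hgη s
      _ = _ := by rw [← hww]; field_simp
  have hmom : ∫⁻ s, ENNReal.ofReal ((∑ i, g i s * ε (s i)) ^ 2) ∂(Measure.pi fun _ : ι => P)
      ≤ ENNReal.ofReal (N * (w * (c ^ 2 + 4 * K ^ 4))) := by
    refine (lintegral_sq_sum_mul_le hm hεm (h.integrable hεm) h0 hgm hg).trans ?_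
    calc _ ≤ ∫⁻ s, (ENNReal.ofReal (N * (w * c ^ 2)) + ∑ i, ENNReal.ofReal w
            * ENNReal.ofReal (ε (s i) ^ 4)) ∂(Measure.pi fun _ : ι => P) := by
          refine lintegral_mono fun s => (ENNReal.ofReal_le_ofReal (hpt s)).trans ?_
          rw [ENNReal.ofReal_add (by positivity) (by positivity),
            ENNReal.ofReal_sum_of_nonneg fun i _ => by positivity]
          simp_rw [ENNReal.ofReal_mul hw0.le]
          exact le_rfl
      _ = ENNReal.ofReal (N * (w * c ^ 2)) + ∑ i : ι, ENNReal.ofReal w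
            * ∫⁻ o, ENNReal.ofReal (ε o ^ 4) ∂P := by
          rw [lintegral_add_left measurable_const, lintegral_finsetSum _ fun i _ => by fun_prop]
          simp only [lintegral_const, measure_univ, mul_one]
          congr 1
          refine Finset.sum_congr rfl fun i _ => ?_
          rw [lintegral_const_mul' _ _ ENNReal.ofReal_ne_top]
          congr 1
          exact (measurePreserving_eval (fun _ : ι => P) i).lintegral_comp
            (f := fun o => ENNReal.ofReal (ε o ^ 4)) (by fun_prop)
      _ ≤ ENNReal.ofReal (N * (w * c ^ 2)) + ∑ _i : ι, ENNReal.ofReal w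
            * ENNReal.ofReal (4 * K ^ 4) := by
          gcongr; exact h.lintegral_pow_four_le
      _ = _ := by
          rw [Finset.sum_const, nsmul_eq_mul, Finset.card_univ, ← ENNReal.ofReal_mul hw0.le,
            ← ENNReal.ofReal_natCast, ← ENNReal.ofReal_mul (by positivity),
            ← ENNReal.ofReal_add (by positivity) (by positivity)]
          congr 1; ring
  have hmark := mul_meas_ge_le_lintegral (μ := Measure.pi fun _ : ι => P)
    (f := fun s => ENNReal.ofReal ((∑ i, g i s * ε (s i)) ^ 2)) (by fun_prop)
    (ENNReal.ofReal (δ ^ 2 * N))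
  have hsub : {s : ι → Ω | δ * Real.sqrt N ≤ |∑ i, g i s * ε (s i)|}
      ⊆ {s | ENNReal.ofReal (δ ^ 2 * N) ≤ ENNReal.ofReal ((∑ i, g i s * ε (s i)) ^ 2)} := by
    intro s (hs : δ * Real.sqrt N ≤ |∑ i, g i s * ε (s i)|)
    refine ENNReal.ofReal_le_ofReal ?_
    have := pow_le_pow_left₀ (by positivity) hs 2
    rwa [mul_pow, Real.sq_sqrt hN'.le, sq_abs] at this
  have hne : ENNReal.ofReal (δ ^ 2 * N) ≠ 0 := by
    simpa using (by positivity : 0 < δ ^ 2 * N)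
  calc _ ≤ _ := measure_mono hsub
    _ ≤ ENNReal.ofReal (N * (w * (c ^ 2 + 4 * K ^ 4))) / ENNReal.ofReal (δ ^ 2 * N) := by
        rw [ENNReal.le_div_iff_mul_le (Or.inl hne) (Or.inl ENNReal.ofReal_ne_top), mul_comm]
        exact hmark.trans hmom
    _ = _ := by
        rw [← ENNReal.ofReal_div_of_pos (by positivity)]
        congr 1; field_simp

end SubGaussian

/-! ### Population moments -/

section Population

variable {p : ℕ}

theorem measurable_treat : Measurable (treat : Obs p → Bool) :=
  measurable_fst.comp measurable_snd

theorem measurable_covarTreat : Measurable (covarTreat : Obs p → (Fin p → ℝ) × Bool) :=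
  measurable_covar.prodMk measurable_treat

theorem measurable_ind : Measurable ind := measurable_of_countable _

theorem measurable_outcomeTreated : Measurable (outcomeTreated : Obs p → ℝ) :=
  (measurable_pi_apply true).comp (measurable_snd.comp measurable_snd)

theorem measurable_dot (t : Fin p → ℝ) : Measurable fun x : Fin p → ℝ => dot x t := by
  unfold dot; fun_prop

theorem measurable_resid (β : Fin p → ℝ) : Measurable (resid β) :=
  measurable_outcomeTreated.sub ((measurable_dot β).comp measurable_covar)

theorem measurable_q : Measurable q := by unfold q; fun_prop

theorem measurable_propResid (θ : Fin p → ℝ) : Measurable (propResid θ) :=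
  (measurable_ind.comp measurable_treat).sub
    (measurable_const.div (measurable_q.comp ((measurable_dot θ).comp measurable_covar)))

theorem one_lt_q (z : ℝ) : 1 < q z := by unfold q; linarith [Real.exp_pos (-z)]

theorem ind_nonneg (w : Bool) : 0 ≤ ind w := by unfold ind; split <;> norm_num

theorem ind_le_one (w : Bool) : ind w ≤ 1 := by unfold ind; split <;> norm_num

theorem ind_sq (w : Bool) : ind w ^ 2 = ind w := by unfold ind; split <;> norm_num

theorem l1_nonneg (t : Fin p → ℝ) : 0 ≤ l1 t := Finset.sum_nonneg fun _ _ => abs_nonneg _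

theorem abs_dot_le {x t : Fin p → ℝ} {B : ℝ} (hx : ∀ j, |x j| ≤ B) : |dot x t| ≤ B * l1 t := by
  unfold dot l1
  rw [Finset.mul_sum]
  refine (Finset.abs_sum_le_sum_abs _ _).trans (Finset.sum_le_sum fun j _ => ?_)
  rw [abs_mul]
  exact mul_le_mul_of_nonneg_right (hx j) (abs_nonneg _)

/-- The propensity error is positive exactly on the treated units, so that the event `W = 1` is an
event about this error. -/
theorem propResid_pos_iff (θ : Fin p → ℝ) (o : Obs p) : 0 < propResid θ o ↔ treat o = true := by
  have h1 := one_lt_q (dot (covar o) θ)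
  have h2 : 1 / q (dot (covar o) θ) < 1 := by rw [div_lt_one (by linarith)]; exact h1
  have h3 : 0 < 1 / q (dot (covar o) θ) := by positivity
  unfold propResid ind
  cases h : treat o <;> simp at * <;> linarith

theorem le_sum_gram {P : Measure (Obs p)} {cmin cmax : ℝ}
    (hE : EigenvalueAssumption P cmin cmax) (h : Fin p → ℝ) :
    cmin * ∑ j, h j ^ 2 ≤ ∑ j, ∑ k, h j * h k * gram P j k := by
  have hsymm : (gram P).IsHermitian := by
    ext j k
    simp [gram, Matrix.conjTranspose_apply, mul_comm]
  have hpsd : (gram P - algebraMap ℝ _ cmin).PosSemidef := by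
    rw [Matrix.posSemidef_iff_isHermitian_and_spectrum_nonneg]
    refine ⟨hsymm.sub ?_, ?_⟩
    · rw [Matrix.algebraMap_eq_diagonal]
      exact Matrix.isHermitian_diagonal _
    · rw [← spectrum.sub_singleton_eq]
      rintro _ ⟨x, hx, y, rfl, rfl⟩
      exact sub_nonneg.2 (hE hx).1
  have h1 := hpsd.dotProduct_mulVec_nonneg h
  rw [Matrix.sub_mulVec, dotProduct_sub, Algebra.algebraMap_eq_smul_one, Matrix.smul_mulVec,
    Matrix.one_mulVec, dotProduct_smul] at h1
  have h2 : star h ⬝ᵥ (gram P).mulVec h = ∑ j, ∑ k, h j * h k * gram P j k := by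
    simp only [dotProduct, Matrix.mulVec, Finset.mul_sum, star_trivial]
    exact Finset.sum_congr rfl fun j _ => Finset.sum_congr rfl fun k _ => by ring
  have h3 : star h ⬝ᵥ h = ∑ j, h j ^ 2 := by
    simp only [dotProduct, star_trivial, sq]
  rw [h2, h3, smul_eq_mul] at h1
  linarith

variable {P : Measure (Obs p)} [IsProbabilityMeasure P] {β θ : Fin p → ℝ} {B κ : ℝ}

theorem integrable_of_ae_abs_le {f : Obs p → ℝ} (hf : Measurable f) {c : ℝ}
    (h : ∀ᵐ o ∂P, |f o| ≤ c) : Integrable f P :=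
  (integrable_const c).mono' hf.aestronglyMeasurable h

theorem integrable_dot_covar (hB : ∀ᵐ o ∂P, ∀ j, |covar o j| ≤ B) (t : Fin p → ℝ) :
    Integrable (fun o => dot (covar o) t) P :=
  integrable_of_ae_abs_le ((measurable_dot t).comp measurable_covar)
    (hB.mono fun _ ho => abs_dot_le ho)

theorem integrable_propResid (θ : Fin p → ℝ) : Integrable (propResid θ) P :=
  integrable_of_ae_abs_le (measurable_propResid θ) (c := 1) (Eventually.of_forall fun o => by
    have h1 := one_lt_q (dot (covar o) θ)
    have h2 : 1 / q (dot (covar o) θ) ≤ 1 := by rw [div_le_one (by linarith)]; exact h1.le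
    have h3 : 0 ≤ 1 / q (dot (covar o) θ) := by positivity
    have h4 := ind_nonneg (treat o)
    have h5 := ind_le_one (treat o)
    unfold propResid
    rw [abs_le]; constructor <;> linarith)

theorem measurable_covar_sigmaX : Measurable[sigmaX p] (covar : Obs p → Fin p → ℝ) :=
  comap_measurable _

theorem condExp_resid_sigmaX (hL : LinearLogistic P β θ) (hB : ∀ᵐ o ∂P, ∀ j, |covar o j| ≤ B)
    (hε : Integrable (resid β) P) : P[resid β | sigmaX p] =ᵐ[P] 0 := by
  have hd := integrable_dot_covar hB β
  have hY : Integrable (outcomeTreated : Obs p → ℝ) P := by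
    refine (hε.add hd).congr (Eventually.of_forall fun o => ?_)
    simp [resid]
  have h1 : P[resid β | sigmaX p] =ᵐ[P]
      P[outcomeTreated | sigmaX p] - P[fun o => dot (covar o) β | sigmaX p] :=
    condExp_sub hY hd _
  have h2 : P[fun o => dot (covar o) β | sigmaX p] = fun o => dot (covar o) β :=
    condExp_of_stronglyMeasurable sigmaX_le
      ((measurable_dot β).comp measurable_covar_sigmaX).stronglyMeasurable hd
  filter_upwards [h1, hL.outcome_model] with o ho1 ho2
  rw [ho1, h2]
  simp [ho2]

theorem condExp_propResid_sigmaX (hL : LinearLogistic P β θ) :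
    P[propResid θ | sigmaX p] =ᵐ[P] 0 := by
  have hw : Integrable (fun o : Obs p => ind (treat o)) P :=
    integrable_of_ae_abs_le (measurable_ind.comp measurable_treat) (c := 1)
      (Eventually.of_forall fun o => by
        rw [abs_of_nonneg (ind_nonneg _)]; exact ind_le_one _)
  have hem : Measurable[sigmaX p] fun o : Obs p => 1 / q (dot (covar o) θ) :=
    measurable_const.div (measurable_q.comp ((measurable_dot θ).comp measurable_covar_sigmaX))
  have he : Integrable (fun o : Obs p => 1 / q (dot (covar o) θ)) P :=
    integrable_of_ae_abs_le (hem.mono sigmaX_le le_rfl) (c := 1)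
      (Eventually.of_forall fun o => by
        have h1 := one_lt_q (dot (covar o) θ)
        rw [abs_of_nonneg (by positivity), div_le_one (by linarith)]; exact h1.le)
  have h1 : P[propResid θ | sigmaX p] =ᵐ[P]
      P[fun o => ind (treat o) | sigmaX p] - P[fun o => 1 / q (dot (covar o) θ) | sigmaX p] :=
    condExp_sub hw he _
  have h2 : P[fun o => 1 / q (dot (covar o) θ) | sigmaX p] = fun o => 1 / q (dot (covar o) θ) :=
    condExp_of_stronglyMeasurable sigmaX_le hem.stronglyMeasurable he
  filter_upwards [h1, hL.propensity_model] with o ho1 ho2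
  rw [ho1, h2]
  simp [ho2, q]

/-- The error has mean zero on every event that is determined by `X`, intersected with the treated
units: this is where conditional independence of the two errors enters. -/
theorem setIntegral_resid_treated (hL : LinearLogistic P β θ)
    (hB : ∀ᵐ o ∂P, ∀ j, |covar o j| ≤ B) (hε : Integrable (resid β) P)
    {A : Set (Obs p)} (hA : MeasurableSet[sigmaX p] A) :
    ∫ o in A ∩ {o | treat o = true}, resid β o ∂P = 0 := by
  have hA' : MeasurableSet A := sigmaX_le _ hA
  have hT : MeasurableSet {o : Obs p | treat o = true} :=
    measurable_treat (measurableSet_singleton true)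
  set T : Set (Obs p) := {o | treat o = true} with hTdef
  have hTpre : T = propResid θ ⁻¹' Set.Ioi 0 := by
    ext o; exact (propResid_pos_iff θ o).symm
  set e : Obs p → ℝ := fun o => 1 / q (dot (covar o) θ) with hedef
  have hem : Measurable[sigmaX p] e :=
    measurable_const.div (measurable_q.comp ((measurable_dot θ).comp measurable_covar_sigmaX))
  have hem' : Measurable e := hem.mono sigmaX_le le_rfl
  have he0 : ∀ o, 0 ≤ e o := fun o => by
    have h1 := one_lt_q (dot (covar o) θ)
    simp only [hedef]; positivity
  have he1 : ∀ o, |e o| ≤ 1 := fun o => by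
    have h1 := one_lt_q (dot (covar o) θ)
    rw [abs_of_nonneg (he0 o)]
    simp only [hedef]
    rw [div_le_one (by linarith)]; exact h1.le
  have hTe : P⟦T | sigmaX p⟧ =ᵐ[P] e := by
    have : (T.indicator fun _ => (1 : ℝ)) = fun o => ind (treat o) := by
      ext o
      by_cases h : treat o = true <;> simp [hTdef, ind, h]
    rw [this]
    exact hL.propensity_model
  have hkey : ∀ s : Set ℝ, MeasurableSet s →
      P.real (resid β ⁻¹' s ∩ (A ∩ T)) = ∫ o in A, (resid β ⁻¹' s).indicator e o ∂P := by
    intro s hs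
    have hsm : MeasurableSet (resid β ⁻¹' s) := measurable_resid β hs
    have hci := (condIndepFun_iff_condExp_inter_preimage_eq_mul (measurable_resid β)
      (measurable_propResid θ)).1 hL.unconfounded s (Set.Ioi 0) hs measurableSet_Ioi
    rw [← hTpre] at hci
    have hpull : P[e * (resid β ⁻¹' s).indicator (fun _ => (1 : ℝ)) | sigmaX p]
        =ᵐ[P] e * P⟦resid β ⁻¹' s | sigmaX p⟧ :=
      condExp_stronglyMeasurable_mul_of_bound sigmaX_le hem.stronglyMeasurable
        ((integrable_const 1).indicator hsm) 1 (Eventually.of_forall he1)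
    have hind : (resid β ⁻¹' s).indicator e
        = e * (resid β ⁻¹' s).indicator (fun _ => (1 : ℝ)) := by
      ext o
      by_cases h : o ∈ resid β ⁻¹' s
      · simp only [Set.indicator_of_mem h, Pi.mul_apply, mul_one]
      · simp only [Set.indicator_of_notMem h, Pi.mul_apply, mul_zero]
    have hint : Integrable ((resid β ⁻¹' s).indicator e) P :=
      (integrable_of_ae_abs_le hem' (Eventually.of_forall he1)).indicator hsm
    have h1 : ∫ o in A, (P[(resid β ⁻¹' s).indicator e | sigmaX p]) o ∂P
        = ∫ o in A, (resid β ⁻¹' s).indicator e o ∂P := setIntegral_condExp sigmaX_le hint hA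
    have h2 : ∫ o in A, (P⟦resid β ⁻¹' s ∩ T | sigmaX p⟧) o ∂P
        = ∫ o in A, (resid β ⁻¹' s ∩ T).indicator (fun _ => (1 : ℝ)) o ∂P :=
      setIntegral_condExp sigmaX_le ((integrable_const 1).indicator (hsm.inter hT)) hA
    rw [← h1, show resid β ⁻¹' s ∩ (A ∩ T) = (resid β ⁻¹' s ∩ T) ∩ A by
      ext o; simp only [Set.mem_inter_iff]; tauto]
    have h3 : ∫ o in A, (resid β ⁻¹' s ∩ T).indicator (fun _ => (1 : ℝ)) o ∂P
        = P.real ((resid β ⁻¹' s ∩ T) ∩ A) := by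
      rw [integral_indicator (hsm.inter hT)]
      simp [Measure.real, Measure.restrict_apply (hsm.inter hT)]
    rw [← h3, ← h2]
    refine integral_congr_ae (ae_restrict_of_ae ?_)
    rw [hind]
    filter_upwards [hci, hpull, hTe] with o o1 o2 o3
    rw [o1, o2, o3, Pi.mul_apply, mul_comm]
  -- on `A`, restricting to the treated units and weighting by the propensity score give the error
  -- the same law
  have hmeas : (P.restrict (A ∩ T)).map (resid β)
      = ((P.restrict A).withDensity fun o => ENNReal.ofReal (e o)).map (resid β) := by
    ext s hs
    have hsm : MeasurableSet (resid β ⁻¹' s) := measurable_resid β hs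
    rw [Measure.map_apply (measurable_resid β) hs, Measure.map_apply (measurable_resid β) hs,
      Measure.restrict_apply hsm, withDensity_apply _ hsm, ← lintegral_indicator hsm]
    have h1 := hkey s hs
    rw [← ENNReal.ofReal_toReal (measure_ne_top P (resid β ⁻¹' s ∩ (A ∩ T)))]
    rw [Measure.real] at h1
    rw [h1, ofReal_integral_eq_lintegral_ofReal]
    · refine lintegral_congr fun o => ?_
      by_cases h : o ∈ resid β ⁻¹' s
      · simp only [Set.indicator_of_mem h]
      · simp only [Set.indicator_of_notMem h, ENNReal.ofReal_zero]
    · exact ((integrable_of_ae_abs_le hem' (Eventually.of_forall he1)).indicator hsm).restrict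
    · exact Eventually.of_forall fun o => Set.indicator_nonneg (fun o _ => he0 o) o
  have hid : ∀ (μ : Measure (Obs p)), ∫ o, resid β o ∂μ = ∫ x, x ∂(μ.map (resid β)) := fun μ =>
    (integral_map (measurable_resid β).aemeasurable
      (f := fun x : ℝ => x) measurable_id.aestronglyMeasurable).symm
  rw [hid, hmeas, ← hid, integral_withDensity_eq_integral_toReal_smul hem'.ennreal_ofReal
    (Eventually.of_forall fun o => ENNReal.ofReal_lt_top)]
  have hz := integral_mul_eq_zero_of_condExp_eq_zero sigmaX_le hε
    (condExp_resid_sigmaX hL hB hε) (l := A.indicator e) (hem.indicator hA) (c := 1)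
    (Eventually.of_forall fun o => by
      by_cases h : o ∈ A
      · rw [Set.indicator_of_mem h]; exact he1 o
      · rw [Set.indicator_of_notMem h]; simp)
  rw [← hz, ← integral_indicator hA']
  refine integral_congr_ae (Eventually.of_forall fun o => ?_)
  by_cases h : o ∈ A
  · simp only [Set.indicator_of_mem h, smul_eq_mul, ENNReal.toReal_ofReal (he0 o)]
  · simp only [Set.indicator_of_notMem h, zero_mul]

/-- `E[ε | X, W] = 0`. -/
theorem condExp_resid_covarTreat (hL : LinearLogistic P β θ)
    (hB : ∀ᵐ o ∂P, ∀ j, |covar o j| ≤ B) (hε : Integrable (resid β) P) :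
    P[resid β | MeasurableSpace.comap covarTreat inferInstance] =ᵐ[P] 0 := by
  refine (ae_eq_condExp_of_forall_setIntegral_eq measurable_covarTreat.comap_le hε
    (fun s _ _ => integrable_zero _ _ _) ?_ stronglyMeasurable_zero.aestronglyMeasurable).symm
  rintro s ⟨U, hU, rfl⟩ -
  have hT : MeasurableSet {o : Obs p | treat o = true} :=
    measurable_treat (measurableSet_singleton true)
  have hsec : ∀ w : Bool, MeasurableSet[sigmaX p] {o : Obs p | (covar o, w) ∈ U} := fun w =>
    ⟨{x | (x, w) ∈ U}, (measurable_prodMk_right : Measurable fun x : Fin p → ℝ => (x, w)) hU, rfl⟩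
  have hzero : ∀ A, MeasurableSet[sigmaX p] A → ∫ o in A, resid β o ∂P = 0 := by
    intro A hA
    rw [← setIntegral_condExp sigmaX_le hε hA]
    refine integral_eq_zero_of_ae (ae_restrict_of_ae (condExp_resid_sigmaX hL hB hε))
  have hsplit := integral_inter_add_sdiff (μ := P) (f := resid β)
    (s := covarTreat ⁻¹' U) hT hε.integrableOn
  have e1 : (covarTreat ⁻¹' U) ∩ {o : Obs p | treat o = true}
      = {o : Obs p | (covar o, true) ∈ U} ∩ {o | treat o = true} := by
    ext o
    simp only [Set.mem_inter_iff, Set.mem_preimage, covarTreat, Set.mem_ofPred_eq]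
    constructor <;> rintro ⟨h1, h2⟩ <;> exact ⟨by simpa [h2] using h1, h2⟩
  have e0 : (covarTreat ⁻¹' U) \ {o : Obs p | treat o = true}
      = {o : Obs p | (covar o, false) ∈ U} \ {o | treat o = true} := by
    ext o
    simp only [Set.mem_sdiff, Set.mem_preimage, covarTreat, Set.mem_ofPred_eq, Bool.not_eq_true]
    constructor <;> rintro ⟨h1, h2⟩ <;> exact ⟨by simpa [h2] using h1, h2⟩
  have hsplit0 := integral_inter_add_sdiff (μ := P) (f := resid β)
    (s := {o : Obs p | (covar o, false) ∈ U}) hT hε.integrableOn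
  rw [hzero _ (hsec false), setIntegral_resid_treated hL hB hε (hsec false), zero_add] at hsplit0
  rw [e1, e0, setIntegral_resid_treated hL hB hε (hsec true), hsplit0] at hsplit
  rw [← hsplit]
  simp

/-- The true weights balance the covariates in the population. -/
theorem integral_balance_eq_zero (hL : LinearLogistic P β θ)
    (hB : ∀ᵐ o ∂P, ∀ j, |covar o j| ≤ B) (j : Fin p) :
    ∫ o, (1 - ind (treat o) * (1 + Real.exp (-dot (covar o) θ))) * covar o j ∂P = 0 := by
  have hz := integral_mul_eq_zero_of_condExp_eq_zero sigmaX_le (integrable_propResid θ)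
    (condExp_propResid_sigmaX hL)
    (l := fun o => -(q (dot (covar o) θ) * covar o j))
    (((measurable_q.comp ((measurable_dot θ).comp measurable_covar_sigmaX)).mul
      ((measurable_pi_apply j).comp measurable_covar_sigmaX)).neg)
    (c := (1 + Real.exp (B * l1 θ)) * B) (by
      filter_upwards [hB] with o ho
      rw [abs_neg, abs_mul, abs_of_pos (by linarith [one_lt_q (dot (covar o) θ)])]
      have h1 : q (dot (covar o) θ) ≤ 1 + Real.exp (B * l1 θ) := by
        unfold q
        have := (abs_le.1 (abs_dot_le (t := θ) ho)).1
        gcongr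
        linarith
      have := abs_nonneg (covar o j)
      gcongr
      exact ho j)
  rw [← hz]
  congr 1
  ext o
  have h1 := one_lt_q (dot (covar o) θ)
  have h2 : q (dot (covar o) θ) * (1 / q (dot (covar o) θ)) = 1 := by field_simp
  unfold propResid
  rw [show 1 + Real.exp (-dot (covar o) θ) = q (dot (covar o) θ) from rfl]
  linear_combination (-(covar o j)) * h2

/-- The matrix `E[W X X']`. -/
def treatedGram (P : Measure (Obs p)) (j k : Fin p) : ℝ :=
  ∫ o, ind (treat o) * (covar o j * covar o k) ∂P

theorem dot_sq_eq (x h : Fin p → ℝ) : dot x h ^ 2 = ∑ j, ∑ k, h j * h k * (x j * x k) := by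
  unfold dot
  rw [sq, Finset.sum_mul_sum]
  exact Finset.sum_congr rfl fun j _ => Finset.sum_congr rfl fun k _ => by ring

theorem integrable_covar_mul (hB : ∀ᵐ o ∂P, ∀ j, |covar o j| ≤ B) (j k : Fin p) :
    Integrable (fun o => covar o j * covar o k) P :=
  integrable_of_ae_abs_le (((measurable_pi_apply j).comp measurable_covar).mul
    ((measurable_pi_apply k).comp measurable_covar)) (c := B * B) (by
      filter_upwards [hB] with o ho
      have := (abs_nonneg _).trans (ho j)
      rw [abs_mul]
      exact mul_le_mul (ho j) (ho k) (abs_nonneg _) this)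

theorem integrable_ind_mul_covar_mul (hB : ∀ᵐ o ∂P, ∀ j, |covar o j| ≤ B) (j k : Fin p) :
    Integrable (fun o => ind (treat o) * (covar o j * covar o k)) P :=
  (integrable_covar_mul hB j k).bdd_mul (c := 1)
    (measurable_ind.comp measurable_treat).aestronglyMeasurable
    (Eventually.of_forall fun o => by
      rw [Real.norm_eq_abs, abs_of_nonneg (ind_nonneg _)]; exact ind_le_one _)

/-- The eigenvalue assumption passes to the treated units, as the propensity score is bounded away
from zero. -/
theorem le_sum_treatedGram (hL : LinearLogistic P β θ) (hB : ∀ᵐ o ∂P, ∀ j, |covar o j| ≤ B)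
    {cmin cmax : ℝ} (hE : EigenvalueAssumption P cmin cmax) (hB0 : 0 ≤ B) (hκ : l1 θ ≤ κ)
    (h : Fin p → ℝ) :
    cmin / (1 + Real.exp (B * κ)) * ∑ j, h j ^ 2 ≤ ∑ j, ∑ k, h j * h k * treatedGram P j k := by
  have hdm : ∀ t : Fin p → ℝ, Measurable fun o : Obs p => dot (covar o) t := fun t =>
    (measurable_dot t).comp measurable_covar
  have hsq : ∀ᵐ o ∂P, |dot (covar o) h ^ 2| ≤ (B * l1 h) ^ 2 := by
    filter_upwards [hB] with o ho
    rw [abs_pow]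
    exact pow_le_pow_left₀ (abs_nonneg _) (abs_dot_le ho) 2
  have hsqi : Integrable (fun o => dot (covar o) h ^ 2) P :=
    integrable_of_ae_abs_le ((hdm h).pow_const 2) hsq
  have e1 : ∑ j, ∑ k, h j * h k * treatedGram P j k
      = ∫ o, ind (treat o) * dot (covar o) h ^ 2 ∂P := by
    have : ∀ o : Obs p, ind (treat o) * dot (covar o) h ^ 2
        = ∑ j, ∑ k, h j * h k * (ind (treat o) * (covar o j * covar o k)) := by
      intro o
      rw [dot_sq_eq, Finset.mul_sum]
      refine Finset.sum_congr rfl fun j _ => ?_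
      rw [Finset.mul_sum]
      exact Finset.sum_congr rfl fun k _ => by ring
    simp_rw [this]
    rw [integral_finsetSum _ fun j _ => integrable_finsetSum _ fun k _ =>
      (integrable_ind_mul_covar_mul hB j k).const_mul _]
    refine Finset.sum_congr rfl fun j _ => ?_
    rw [integral_finsetSum _ fun k _ => (integrable_ind_mul_covar_mul hB j k).const_mul _]
    refine Finset.sum_congr rfl fun k _ => ?_
    rw [integral_const_mul]; rfl
  have e2 : ∑ j, ∑ k, h j * h k * gram P j k = ∫ o, dot (covar o) h ^ 2 ∂P := by
    simp_rw [dot_sq_eq]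
    rw [integral_finsetSum _ fun j _ => integrable_finsetSum _ fun k _ =>
      (integrable_covar_mul hB j k).const_mul _]
    refine Finset.sum_congr rfl fun j _ => ?_
    rw [integral_finsetSum _ fun k _ => (integrable_covar_mul hB j k).const_mul _]
    refine Finset.sum_congr rfl fun k _ => ?_
    rw [integral_const_mul]; rfl
  have hz := integral_mul_eq_zero_of_condExp_eq_zero sigmaX_le (integrable_propResid θ)
    (condExp_propResid_sigmaX hL)
    (l := fun o => dot (covar o) h ^ 2)
    (((measurable_dot h).comp measurable_covar_sigmaX).pow_const 2) hsq
  have hi1 : Integrable (fun o => dot (covar o) h ^ 2 * propResid θ o) P :=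
    (integrable_propResid θ).bdd_mul ((hdm h).pow_const 2).aestronglyMeasurable hsq
  have hi2 : Integrable (fun o => 1 / q (dot (covar o) θ) * dot (covar o) h ^ 2) P :=
    hsqi.bdd_mul (c := 1)
      (measurable_const.div (measurable_q.comp (hdm θ))).aestronglyMeasurable
      (Eventually.of_forall fun o => by
        have h1 := one_lt_q (dot (covar o) θ)
        rw [Real.norm_eq_abs, abs_of_nonneg (by positivity), div_le_one (by linarith)]
        exact h1.le)
  have e3 : ∫ o, ind (treat o) * dot (covar o) h ^ 2 ∂P
      = ∫ o, 1 / q (dot (covar o) θ) * dot (covar o) h ^ 2 ∂P := by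
    rw [← add_zero (∫ o, 1 / q (dot (covar o) θ) * dot (covar o) h ^ 2 ∂P), ← hz,
      ← integral_add hi2 hi1]
    congr 1; ext o
    unfold propResid; ring
  rw [e1, e3]
  calc cmin / (1 + Real.exp (B * κ)) * ∑ j, h j ^ 2
      = 1 / (1 + Real.exp (B * κ)) * (cmin * ∑ j, h j ^ 2) := by ring
    _ ≤ 1 / (1 + Real.exp (B * κ)) * ∫ o, dot (covar o) h ^ 2 ∂P := by
        rw [← e2]; gcongr; exact le_sum_gram hE h
    _ = ∫ o, 1 / (1 + Real.exp (B * κ)) * dot (covar o) h ^ 2 ∂P := by rw [integral_const_mul]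
    _ ≤ _ := by
        refine integral_mono_ae (hsqi.const_mul _) hi2 ?_
        filter_upwards [hB] with o ho
        have h1 := (abs_le.1 (abs_dot_le (t := θ) ho)).1
        have h2 : q (dot (covar o) θ) ≤ 1 + Real.exp (B * κ) := by
          unfold q
          gcongr
          nlinarith
        have h3 := one_lt_q (dot (covar o) θ)
        show 1 / (1 + Real.exp (B * κ)) * dot (covar o) h ^ 2
          ≤ 1 / q (dot (covar o) θ) * dot (covar o) h ^ 2
        gcongr

end Population

/-! ### The `ℓ₁`-norm -/

section Norms

variable {p : ℕ}

theorem dot_add (x s t : Fin p → ℝ) : dot x (s + t) = dot x s + dot x t := by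
  simp [dot, mul_add, Finset.sum_add_distrib]

theorem dot_sub (x s t : Fin p → ℝ) : dot x (s - t) = dot x s - dot x t := by
  simp [dot, mul_sub, Finset.sum_sub_distrib]

theorem l1_add_le (s t : Fin p → ℝ) : l1 (s + t) ≤ l1 s + l1 t := by
  unfold l1
  rw [← Finset.sum_add_distrib]
  exact Finset.sum_le_sum fun j _ => abs_add_le _ _

theorem l1_sub_le (s t : Fin p → ℝ) : l1 (s - t) ≤ l1 s + l1 t := by
  unfold l1
  rw [← Finset.sum_add_distrib]
  exact Finset.sum_le_sum fun j _ => abs_sub _ _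

theorem l1_zero : l1 (0 : Fin p → ℝ) = 0 := by simp [l1]

theorem l1_single (j : Fin p) (u : ℝ) : l1 (Pi.single j u : Fin p → ℝ) = |u| := by
  unfold l1
  rw [Finset.sum_eq_single j]
  · simp
  · intro k _ hk; simp [hk]
  · simp

theorem eq_zero_of_l1_le {t : Fin p → ℝ} (h : l1 t ≤ 0) : t = 0 := by
  funext j
  have h1 := (Finset.sum_eq_zero_iff_of_nonneg fun k _ => abs_nonneg (t k)).1
    (le_antisymm h (l1_nonneg t)) j (Finset.mem_univ j)
  simpa using h1

theorem norm_le_l1 (t : Fin p → ℝ) : ‖t‖ ≤ l1 t :=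
  (pi_norm_le_iff_of_nonneg (l1_nonneg t)).2 fun j =>
    Finset.single_le_sum (f := fun k => |t k|) (fun _ _ => abs_nonneg _) (Finset.mem_univ j)

theorem continuous_l1 : Continuous (l1 : (Fin p → ℝ) → ℝ) := by
  unfold l1; fun_prop

theorem sum_mul_le_l1 {v h : Fin p → ℝ} {lam : ℝ} (hv : ∀ j, |v j| ≤ lam) :
    |∑ j, v j * h j| ≤ lam * l1 h := abs_dot_le hv

theorem isBounded_setOf_l1_le (R : ℝ) : Bornology.IsBounded {t : Fin p → ℝ | l1 t ≤ R} :=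
  (Metric.isBounded_closedBall (x := (0 : Fin p → ℝ)) (r := R)).subset fun t ht => by
    rw [mem_closedBall_zero_iff]; exact (norm_le_l1 t).trans ht

theorem exists_isMinOn_of_l1_coercive {f : (Fin p → ℝ) → ℝ} (hf : Continuous f) {A c : ℝ}
    (hc : 0 < c) (h : ∀ t, A + c * l1 t ≤ f t) : ∃ y ∈ Set.univ, IsMinOn f Set.univ y := by
  obtain ⟨y, hy⟩ := hf.exists_forall_le_of_isBounded 0
    ((isBounded_setOf_l1_le ((f 0 - A) / c)).subset fun t (ht : f t ≤ f 0) => by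
      show l1 t ≤ _
      rw [le_div_iff₀ hc]
      linarith [h t])
  exact ⟨y, Set.mem_univ y, fun z _ => hy z⟩

end Norms

/-! ### The covariate-balancing propensity estimate -/

section Propensity

variable {p : ℕ} {ι : Type*} [Fintype ι]

/-- The covariate imbalance of the weights `1 + exp(-X't)`: the gradient of the smooth part of the
covariate-balancing loss. -/
def balance (d : ι → (Fin p → ℝ) × Bool) (t : Fin p → ℝ) (j : Fin p) : ℝ :=
  (1 / (Fintype.card ι : ℝ)) *
    ∑ i, (1 - ind (d i).2 * (1 + Real.exp (-dot (d i).1 t))) * (d i).1 j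

theorem sum_balance_mul (d : ι → (Fin p → ℝ) × Bool) (t h : Fin p → ℝ) :
    ∑ j, balance d t j * h j = (1 / (Fintype.card ι : ℝ)) *
      ∑ i, (1 - ind (d i).2 * (1 + Real.exp (-dot (d i).1 t))) * dot (d i).1 h := by
  unfold balance dot
  simp_rw [mul_assoc, ← Finset.mul_sum, Finset.sum_mul]
  congr 1
  rw [Finset.sum_comm]
  simp_rw [Finset.mul_sum, mul_assoc]

theorem continuous_balance (d : ι → (Fin p → ℝ) × Bool) (j : Fin p) :
    Continuous fun t => balance d t j := by
  unfold balance dot; fun_prop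

theorem continuous_propLoss (d : ι → (Fin p → ℝ) × Bool) (lam : ℝ) :
    Continuous (propLoss d lam) := by
  unfold propLoss dot l1; fun_prop

/-- The convex part of the loss lies above its tangent at `t`. -/
theorem propLoss_tangent_le (d : ι → (Fin p → ℝ) × Bool) (lam : ℝ) (t s : Fin p → ℝ) :
    propLoss d lam t + ∑ j, balance d t j * (s - t) j + lam * (l1 s - l1 t)
      ≤ propLoss d lam s := by
  rw [sum_balance_mul]
  unfold propLoss
  have hN : (0 : ℝ) ≤ 1 / (Fintype.card ι : ℝ) := by positivity
  have hpt : ∀ i, ((1 - ind (d i).2) * dot (d i).1 t + ind (d i).2 * Real.exp (-dot (d i).1 t))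
      + (1 - ind (d i).2 * (1 + Real.exp (-dot (d i).1 t))) * dot (d i).1 (s - t)
      ≤ (1 - ind (d i).2) * dot (d i).1 s + ind (d i).2 * Real.exp (-dot (d i).1 s) := by
    intro i
    rw [dot_sub]
    have h1 := Real.add_one_le_exp (dot (d i).1 t - dot (d i).1 s)
    have h2 : Real.exp (-dot (d i).1 s)
        = Real.exp (-dot (d i).1 t) * Real.exp (dot (d i).1 t - dot (d i).1 s) := by
      rw [← Real.exp_add]; congr 1; ring
    rw [h2]
    have h3 := mul_le_mul_of_nonneg_left h1
      (mul_nonneg (ind_nonneg (d i).2) (Real.exp_pos (-dot (d i).1 t)).le)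
    nlinarith [h3]
  have := mul_le_mul_of_nonneg_left (Finset.sum_le_sum fun i (_ : i ∈ Finset.univ) => hpt i) hN
  rw [Finset.sum_add_distrib, mul_add] at this
  linarith

theorem exists_isMinOn_propLoss {d : ι → (Fin p → ℝ) × Bool} {lam : ℝ} (hlam : 0 < lam)
    {θ : Fin p → ℝ} (h : ∀ j, |balance d θ j| ≤ lam / 2) :
    ∃ y ∈ Set.univ, IsMinOn (propLoss d lam) Set.univ y := by
  refine exists_isMinOn_of_l1_coercive (continuous_propLoss d lam)
    (A := propLoss d lam θ - 3 / 2 * lam * l1 θ) (half_pos hlam) fun t => ?_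
  have h1 := propLoss_tangent_le d lam θ t
  have h2 := (abs_le.1 (sum_mul_le_l1 (h := t - θ) h)).1
  have h3 := l1_sub_le t θ
  nlinarith

/-- The Karush–Kuhn–Tucker bound for the penalized loss. -/
theorem abs_balance_le_of_isMinOn {d : ι → (Fin p → ℝ) × Bool} {lam : ℝ} (hlam : 0 ≤ lam)
    {t : Fin p → ℝ} (ht : IsMinOn (propLoss d lam) Set.univ t) (j : Fin p) :
    |balance d t j| ≤ lam := by
  have hcont : Continuous fun u : ℝ => balance d (t + Pi.single j u) j :=
    (continuous_balance d j).comp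
      (continuous_const.add (continuous_single (A := fun _ : Fin p => ℝ) j))
  have hlim : Tendsto (fun u : ℝ => balance d (t + Pi.single j u) j) (𝓝 0)
      (𝓝 (balance d t j)) := by
    have := hcont.tendsto 0
    simpa using this
  have hkey : ∀ u : ℝ, -(lam * |u|) ≤ u * balance d (t + Pi.single j u) j := by
    intro u
    have h1 := propLoss_tangent_le d lam (t + Pi.single j u) t
    have h2 : propLoss d lam t ≤ propLoss d lam (t + Pi.single j u) := ht (Set.mem_univ _)
    have h3 : ∑ k, balance d (t + Pi.single j u) k * (t - (t + (Pi.single j u : Fin p → ℝ))) k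
        = -(u * balance d (t + Pi.single j u) j) := by
      rw [Finset.sum_eq_single j]
      · simp; ring
      · intro k _ hk; simp [hk]
      · simp
    have h4 : l1 (t + Pi.single j u) ≤ l1 t + |u| := by
      rw [← l1_single j u]; exact l1_add_le _ _
    rw [h3] at h1
    nlinarith
  rw [abs_le]
  constructor
  · refine ge_of_tendsto (hlim.mono_left (nhdsWithin_le_nhds (s := Set.Ioi 0))) ?_
    filter_upwards [self_mem_nhdsWithin] with u (hu : 0 < u)
    have := hkey u
    rw [abs_of_pos hu] at this
    by_contra hcon
    nlinarith [mul_lt_mul_of_pos_left (not_le.1 hcon) hu]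
  · refine le_of_tendsto (hlim.mono_left (nhdsWithin_le_nhds (s := Set.Iio 0))) ?_
    filter_upwards [self_mem_nhdsWithin] with u (hu : u < 0)
    have := hkey u
    rw [abs_of_neg hu] at this
    by_contra hcon
    nlinarith [mul_lt_mul_of_neg_left (not_le.1 hcon) hu]

theorem exists_isMinOn_l1_balancingSet {d : ι → (Fin p → ℝ) × Bool} {lam : ℝ}
    {θ : Fin p → ℝ} (h : θ ∈ balancingSet d lam) :
    ∃ y ∈ balancingSet d lam, IsMinOn l1 (balancingSet d lam) y := by
  have hclosed : IsClosed (balancingSet d lam) := by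
    have : balancingSet d lam = ⋂ j, {t | |balance d t j| ≤ lam} := by
      ext t; simp [balancingSet, balance]
    rw [this]
    exact isClosed_iInter fun j =>
      isClosed_le (continuous_balance d j).abs continuous_const
  have hcomp : IsCompact (balancingSet d lam ∩ {t | l1 t ≤ l1 θ}) :=
    Metric.isCompact_of_isClosed_isBounded
      (hclosed.inter (isClosed_le continuous_l1 continuous_const))
      ((isBounded_setOf_l1_le _).subset Set.inter_subset_right)
  obtain ⟨y, hy, hmin⟩ := hcomp.exists_isMinOn ⟨θ, h, show l1 θ ≤ l1 θ from le_rfl⟩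
    continuous_l1.continuousOn
  refine ⟨y, hy.1, fun z hz => ?_⟩
  rcases le_total (l1 z) (l1 θ) with hle | hle
  · exact hmin ⟨hz, hle⟩
  · exact le_trans hy.2 hle

/-- When the truth balances the covariates, the output of the algorithm balances them as well, and
its `ℓ₁`-norm is at most `κ`. A zero truth is recovered exactly. -/
theorem IsPropensityOutput.spec {d : ι → (Fin p → ℝ) × Bool} {lam κ : ℝ} {θ t : Fin p → ℝ}
    (ht : IsPropensityOutput d lam κ t) (hlam : 0 < lam) (hκ : l1 θ ≤ κ)
    (h : ∀ j, |balance d θ j| ≤ lam / 2) :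
    l1 t ≤ κ ∧ (∀ j, |balance d t j| ≤ lam) ∧ (θ = 0 → t = 0) := by
  obtain ⟨tc, h1, h2, h3⟩ := ht
  obtain ⟨-, hmin⟩ := h1 (exists_isMinOn_propLoss hlam h)
  rcases le_or_gt (l1 tc) κ with hle | hgt
  · rw [h3 hle]
    refine ⟨hle, abs_balance_le_of_isMinOn hlam.le hmin, ?_⟩
    rintro rfl
    refine eq_zero_of_l1_le ?_
    have e1 := propLoss_tangent_le d lam 0 tc
    have e2 : propLoss d lam tc ≤ propLoss d lam 0 := hmin (Set.mem_univ _)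
    have e3 := (abs_le.1 (sum_mul_le_l1 (h := tc - 0) h)).1
    rw [l1_zero] at e1
    rw [sub_zero] at e1 e3
    nlinarith
  · have hθ : θ ∈ balancingSet d lam := fun j => (h j).trans (by linarith)
    obtain ⟨hmem, hm⟩ := h2 hgt (exists_isMinOn_l1_balancingSet hθ)
    have hle : l1 t ≤ l1 θ := hm hθ
    refine ⟨hle.trans hκ, hmem, ?_⟩
    rintro rfl
    rw [l1_zero] at hle
    exact eq_zero_of_l1_le hle

theorem sq_exp_sub_exp_le {u v M : ℝ} (hu : -M ≤ u) (hv : -M ≤ v) :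
    (Real.exp (-v) - Real.exp (-u)) ^ 2
      ≤ Real.exp M * ((Real.exp (-u) - Real.exp (-v)) * (v - u)) := by
  wlog h : u ≤ v generalizing u v
  · have := this hv hu (not_le.1 h).le
    linarith
  have h1 : Real.exp (-v) ≤ Real.exp (-u) := Real.exp_le_exp.2 (by linarith)
  have h2 : Real.exp (-u) ≤ Real.exp M := Real.exp_le_exp.2 (by linarith)
  have h3 : Real.exp (-u) - Real.exp (-v) ≤ Real.exp M * (v - u) := by
    have e1 := Real.add_one_le_exp (u - v)
    have e2 : Real.exp (-v) = Real.exp (-u) * Real.exp (u - v) := by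
      rw [← Real.exp_add]; congr 1; ring
    rw [e2]
    have e3 := mul_le_mul_of_nonneg_left e1 (Real.exp_pos (-u)).le
    have e4 := mul_le_mul_of_nonneg_right h2 (sub_nonneg.2 h)
    linarith
  have := mul_le_mul_of_nonneg_left h3 (sub_nonneg.2 h1)
  linarith

/-- Two vectors of bounded `ℓ₁`-norm that both balance the covariates give similar weights to the
treated units. No restricted eigenvalue condition is needed for this slow rate. -/
theorem sum_treated_sq_exp_sub_le {d : ι → (Fin p → ℝ) × Bool} {lam κ B : ℝ} {θ t : Fin p → ℝ}
    (hB0 : 0 ≤ B) (hB : ∀ i j, |(d i).1 j| ≤ B) (hθ : l1 θ ≤ κ) (ht : l1 t ≤ κ)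
    (hbθ : ∀ j, |balance d θ j| ≤ lam / 2) (hbt : ∀ j, |balance d t j| ≤ lam) (hlam : 0 ≤ lam) :
    ∑ i, ind (d i).2 * (Real.exp (-dot (d i).1 t) - Real.exp (-dot (d i).1 θ)) ^ 2
      ≤ Fintype.card ι * (3 * κ * Real.exp (B * κ) * lam) := by
  rcases isEmpty_or_nonempty ι with hι | hι
  · simp
  have hN : (0 : ℝ) < Fintype.card ι := by exact_mod_cast Fintype.card_pos
  have hlow : ∀ s : Fin p → ℝ, l1 s ≤ κ → ∀ i, -(B * κ) ≤ dot (d i).1 s := fun s hs i => by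
    have := (abs_le.1 (abs_dot_le (t := s) (hB i))).1
    nlinarith
  have h1 : ∑ j, balance d t j * (t - θ) j - ∑ j, balance d θ j * (t - θ) j
      = (1 / (Fintype.card ι : ℝ)) * ∑ i, ind (d i).2 *
        ((Real.exp (-dot (d i).1 θ) - Real.exp (-dot (d i).1 t))
          * (dot (d i).1 t - dot (d i).1 θ)) := by
    rw [sum_balance_mul, sum_balance_mul, ← mul_sub, ← Finset.sum_sub_distrib]
    congr 1
    refine Finset.sum_congr rfl fun i _ => ?_
    rw [dot_sub]; ring
  have h2 := (abs_le.1 (sum_mul_le_l1 (h := t - θ) hbt)).2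
  have h3 := (abs_le.1 (sum_mul_le_l1 (h := t - θ) hbθ)).1
  have h4 : l1 (t - θ) ≤ 2 * κ := (l1_sub_le t θ).trans (by linarith)
  have h5 : (1 / (Fintype.card ι : ℝ)) * ∑ i, ind (d i).2 *
        ((Real.exp (-dot (d i).1 θ) - Real.exp (-dot (d i).1 t))
          * (dot (d i).1 t - dot (d i).1 θ)) ≤ 3 * κ * lam := by
    rw [← h1]; nlinarith
  rw [one_div, inv_mul_le_iff₀ hN] at h5
  calc _ ≤ ∑ i, Real.exp (B * κ) * (ind (d i).2 *
        ((Real.exp (-dot (d i).1 θ) - Real.exp (-dot (d i).1 t))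
          * (dot (d i).1 t - dot (d i).1 θ))) := by
        refine Finset.sum_le_sum fun i _ => ?_
        have := mul_le_mul_of_nonneg_left (sq_exp_sub_exp_le (hlow θ hθ i) (hlow t ht i))
          (ind_nonneg (d i).2)
        linarith
    _ ≤ Real.exp (B * κ) * (Fintype.card ι * (3 * κ * lam)) := by
        rw [← Finset.mul_sum]
        gcongr
    _ = _ := by ring

end Propensity

/-! ### The weighted lasso -/

section Lasso

variable {p : ℕ} {ι : Type*} [Fintype ι]

theorem exists_isMinOn_outcomeLoss (d : ι → Obs p) (t : Fin p → ℝ) {lam : ℝ} (hlam : 0 < lam) :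
    ∃ y ∈ Set.univ, IsMinOn (outcomeLoss d t lam) Set.univ y := by
  refine exists_isMinOn_of_l1_coercive (by unfold outcomeLoss dot l1; fun_prop) (A := 0) hlam
    fun b => ?_
  unfold outcomeLoss
  have : 0 ≤ (1 / (Fintype.card ι : ℝ)) *
      ∑ i, ind (treat (d i)) * Real.exp (-dot (covar (d i)) t) *
        (outcome (d i) - dot (covar (d i)) b) ^ 2 :=
    mul_nonneg (by positivity) (Finset.sum_nonneg fun i _ =>
      mul_nonneg (mul_nonneg (ind_nonneg _) (Real.exp_pos _).le) (sq_nonneg _))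
  linarith

theorem ind_mul_outcome (o : Obs p) :
    ind (treat o) * outcome o = ind (treat o) * outcomeTreated o := by
  unfold outcome outcomeTreated treat ind
  cases h : o.2.1 <;> simp

theorem sum_support_abs_sq_le (β h : Fin p → ℝ) :
    (∑ j with β j ≠ 0, |h j|) ^ 2 ≤ (l0 β : ℝ) * ∑ j, h j ^ 2 := by
  have hc : l0 β = (Finset.univ.filter fun j => β j ≠ 0).card := by
    unfold l0
    rw [Set.ncard_eq_toFinset_card']
    congr 1
    ext j; simp
  rw [hc]
  refine sq_sum_le_card_mul_sum_sq.trans ?_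
  gcongr
  simp_rw [sq_abs]
  exact Finset.sum_le_sum_of_subset_of_nonneg (Finset.filter_subset _ _)
    fun _ _ _ => sq_nonneg _

/-- The `ℓ₁`-error of the weighted lasso, on the event that the penalty dominates the noise and that
the Gram matrix of the treated units is close to its mean. -/
theorem lasso_l1_error_le {d : ι → Obs p} {t β b : Fin p → ℝ} {lam τ cG ω : ℝ} (hlam : 0 < lam)
    (hb : IsMinOn (outcomeLoss d t lam) Set.univ b)
    (hnoise : ∀ j, |(1 / (Fintype.card ι : ℝ)) * ∑ i, ind (treat (d i)) *
      Real.exp (-dot (covar (d i)) t) * covar (d i) j * resid β (d i)| ≤ lam / 4)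
    (hω0 : 0 < ω) (hω : ∀ i, ω ≤ Real.exp (-dot (covar (d i)) t))
    (hgram : ∀ h : Fin p → ℝ, cG * ∑ j, h j ^ 2 - τ * l1 h ^ 2
      ≤ (1 / (Fintype.card ι : ℝ)) * ∑ i, ind (treat (d i)) * dot (covar (d i)) h ^ 2)
    (hcG : 0 < cG) (hτ0 : 0 ≤ τ) (hτ : 32 * τ * l0 β ≤ cG) :
    l1 (b - β) ≤ 12 * l0 β * lam / (ω * cG) := by
  set h : Fin p → ℝ := b - β with hh
  have hbβ : b = β + h := by rw [hh]; abel
  set N : ℝ := 1 / (Fintype.card ι : ℝ) with hN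
  have hN0 : 0 ≤ N := by positivity
  set Q : ℝ := N * ∑ i, ind (treat (d i)) * Real.exp (-dot (covar (d i)) t) *
    dot (covar (d i)) h ^ 2 with hQ
  set v : Fin p → ℝ := fun j => N * ∑ i, ind (treat (d i)) *
      Real.exp (-dot (covar (d i)) t) * covar (d i) j * resid β (d i) with hv
  have hcross : ∑ j, v j * h j = N * ∑ i, ind (treat (d i)) * Real.exp (-dot (covar (d i)) t) *
      resid β (d i) * dot (covar (d i)) h := by
    simp only [hv, dot]
    simp_rw [mul_assoc, ← Finset.mul_sum, Finset.sum_mul]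
    congr 1
    rw [Finset.sum_comm]
    simp_rw [Finset.mul_sum]
    exact Finset.sum_congr rfl fun i _ => Finset.sum_congr rfl fun j _ => by ring
  have hloss : outcomeLoss d t lam b - outcomeLoss d t lam β
      = Q - 2 * ∑ j, v j * h j + lam * (l1 b - l1 β) := by
    rw [hcross, hQ]
    unfold outcomeLoss
    rw [← hN]
    have e : ∀ i, ind (treat (d i)) * Real.exp (-dot (covar (d i)) t) *
          (outcome (d i) - dot (covar (d i)) b) ^ 2
        = ind (treat (d i)) * Real.exp (-dot (covar (d i)) t) *
          (outcome (d i) - dot (covar (d i)) β) ^ 2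
          + ind (treat (d i)) * Real.exp (-dot (covar (d i)) t) * dot (covar (d i)) h ^ 2
          - 2 * (ind (treat (d i)) * Real.exp (-dot (covar (d i)) t) *
            resid β (d i) * dot (covar (d i)) h) := by
      intro i
      have h1 := ind_mul_outcome (d i)
      have h2 : dot (covar (d i)) b = dot (covar (d i)) β + dot (covar (d i)) h := by
        rw [hbβ, dot_add]
      rw [h2]
      unfold resid
      linear_combination (-2 * Real.exp (-dot (covar (d i)) t) * dot (covar (d i)) h) * h1
    rw [Finset.sum_congr rfl fun i _ => e i, Finset.sum_sub_distrib, Finset.sum_add_distrib,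
      ← Finset.mul_sum]
    ring
  have hmin : outcomeLoss d t lam b ≤ outcomeLoss d t lam β := hb (Set.mem_univ _)
  have hnz := (abs_le.1 (sum_mul_le_l1 (h := h) hnoise)).2
  set hS : ℝ := ∑ j with β j ≠ 0, |h j| with hhS
  set hSc : ℝ := ∑ j with ¬ β j ≠ 0, |h j| with hhSc
  have hS0 : 0 ≤ hS := Finset.sum_nonneg fun _ _ => abs_nonneg _
  have hSc0 : 0 ≤ hSc := Finset.sum_nonneg fun _ _ => abs_nonneg _
  have hsplit : l1 h = hS + hSc := (Finset.sum_filter_add_sum_filter_not _ _ _).symm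
  have hpen : hSc - hS ≤ l1 b - l1 β := by
    have e1 : l1 b - l1 β = ∑ j, (|b j| - |β j|) := by
      unfold l1; rw [Finset.sum_sub_distrib]
    rw [e1, ← Finset.sum_filter_add_sum_filter_not Finset.univ (fun j => β j ≠ 0)]
    have e2 : -hS ≤ ∑ j with β j ≠ 0, (|b j| - |β j|) := by
      rw [hhS, ← Finset.sum_neg_distrib]
      refine Finset.sum_le_sum fun j _ => ?_
      have : |β j| ≤ |b j| + |h j| := by
        have := abs_sub (b j) (h j)
        rwa [show b j - h j = β j by simp [hh]] at this
      linarith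
    have e3 : hSc ≤ ∑ j with ¬ β j ≠ 0, (|b j| - |β j|) := by
      refine Finset.sum_le_sum fun j hj => ?_
      have hz : β j = 0 := by simpa using (Finset.mem_filter.1 hj).2
      simp [hh, hz]
    linarith
  have hQ0 : 0 ≤ Q := mul_nonneg hN0 (Finset.sum_nonneg fun i _ =>
    mul_nonneg (mul_nonneg (ind_nonneg _) (Real.exp_pos _).le) (sq_nonneg _))
  have hbasic : Q + lam / 2 * hSc ≤ 3 / 2 * lam * hS := by
    have := mul_le_mul_of_nonneg_left hpen hlam.le
    rw [hsplit] at hnz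
    change ∑ j, v j * h j ≤ _ at hnz
    nlinarith
  have hcone : l1 h ≤ 4 * hS := by
    have : hSc ≤ 3 * hS := by
      by_contra hcon
      nlinarith [mul_lt_mul_of_pos_left (not_le.1 hcon) hlam]
    linarith
  set H2 : ℝ := ∑ j, h j ^ 2 with hH2
  have hH0 : 0 ≤ H2 := Finset.sum_nonneg fun _ _ => sq_nonneg _
  have hCS : hS ^ 2 ≤ l0 β * H2 := sum_support_abs_sq_le β h
  have hQlow : ω * (cG / 2 * H2) ≤ Q := by
    have e1 : l1 h ^ 2 ≤ 16 * (l0 β * H2) := by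
      have := pow_le_pow_left₀ (l1_nonneg h) hcone 2
      nlinarith
    have e2 : cG / 2 * H2 ≤ cG * H2 - τ * l1 h ^ 2 := by
      have e3 := mul_le_mul_of_nonneg_left e1 hτ0
      have e4 := mul_le_mul_of_nonneg_right hτ hH0
      nlinarith
    have e5 := mul_le_mul_of_nonneg_left (e2.trans (hgram h)) hω0.le
    refine e5.trans ?_
    rw [hQ, ← mul_assoc, mul_comm ω, mul_assoc, Finset.mul_sum]
    refine mul_le_mul_of_nonneg_left (Finset.sum_le_sum fun i _ => ?_) hN0
    have := mul_le_mul_of_nonneg_right (hω i)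
      (mul_nonneg (ind_nonneg (treat (d i))) (sq_nonneg (dot (covar (d i)) h)))
    linarith
  have hfin : hS ≤ 3 * l0 β * lam / (ω * cG) := by
    rw [le_div_iff₀ (by positivity)]
    rcases hS0.eq_or_lt with hz | hpos
    · rw [← hz]; simp; positivity
    · have e1 : hS ^ 2 * (ω * cG / 2) ≤ l0 β * (3 / 2 * lam * hS) := by
        calc hS ^ 2 * (ω * cG / 2) ≤ (l0 β * H2) * (ω * cG / 2) := by gcongr
          _ = l0 β * (ω * (cG / 2 * H2)) := by ring
          _ ≤ l0 β * (3 / 2 * lam * hS) := by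
              refine mul_le_mul_of_nonneg_left (hQlow.trans ?_) (Nat.cast_nonneg _)
              linarith [mul_nonneg hlam.le hSc0]
      have e2 : hS * (hS * (ω * cG)) ≤ hS * (3 * l0 β * lam) := by nlinarith
      exact le_of_mul_le_mul_left e2 hpos
  calc l1 h ≤ 4 * hS := hcone
    _ ≤ 4 * (3 * l0 β * lam / (ω * cG)) := by gcongr
    _ = _ := by ring

end Lasso

/-! ### Maximal inequalities -/

section Maximal

variable {Ω : Type*} {m mΩ : MeasurableSpace Ω} {P : Measure Ω} {ε : Ω → ℝ} {K : ℝ}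
  {ι : Type*} [Fintype ι] [DecidableEq ι]

/-- A union bound over at most `p²` weighted sums, at the rate `√(log p / N)`. -/
theorem measure_pi_exists_ge_rate_le {A : Type*} [Fintype A] (hm : m ≤ mΩ)
    [IsProbabilityMeasure P] {f : A → Ω → ℝ} (hfm : ∀ a, Measurable (f a))
    (h : ∀ a, Psi2NormLE P (f a) K) (h0 : ∀ a, P[f a | m] =ᵐ[P] 0)
    {g : A → ι → (ι → Ω) → ℝ} (hgm : ∀ a i, Measurable (g a i))
    (hg : ∀ a i k s, Measurable[m] fun o => g a k (Function.update s i o))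
    {c : ℝ} (hc : 0 < c) (hgc : ∀ a i s, |g a i s| ≤ c) {p : ℕ} (hp : 0 < p)
    (hA : Fintype.card A ≤ p ^ 2) (hN : 0 < Fintype.card ι)
    (hrate : 16 * Real.log p ≤ Fintype.card ι) :
    (Measure.pi fun _ : ι => P)
        {s | ∃ a, (Fintype.card ι : ℝ) * (8 * c * K * Real.sqrt (Real.log p / Fintype.card ι))
          ≤ |∑ i, g a i s * f a (s i)|}
      ≤ ENNReal.ofReal (2 * Real.exp (-Real.log p)) := by
  have hN' : (0 : ℝ) < Fintype.card ι := by exact_mod_cast hN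
  have hL : 0 ≤ Real.log p := Real.log_natCast_nonneg p
  have hp' : (0 : ℝ) < p := by exact_mod_cast hp
  set N : ℝ := (Fintype.card ι : ℝ) with hNdef
  set L := Real.log p with hLdef
  have hdiv : 0 ≤ L / N := by positivity
  have hρ1 : 4 * Real.sqrt (L / N) ≤ 1 := by
    have : Real.sqrt (L / N) ≤ 1 / 4 := by
      rw [Real.sqrt_le_left (by norm_num), div_le_iff₀ hN']
      linarith
    linarith
  have key := measure_pi_exists_abs_sum_mul_ge_le hm hfm h h0 hgm hg hc hgc
    (by positivity : 0 ≤ 4 * Real.sqrt (L / N)) hρ1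
  have e1 : 2 * c * K * (4 * Real.sqrt (L / N)) = 8 * c * K * Real.sqrt (L / N) := by ring
  have e2 : -N * (4 * Real.sqrt (L / N)) ^ 2 = -(16 * L) := by
    rw [mul_pow, Real.sq_sqrt hdiv]; field_simp; ring
  rw [e1, ← hNdef, e2] at key
  refine key.trans ?_
  have e3 : Real.exp L = p := Real.exp_log hp'
  calc (Fintype.card A : ENNReal) * (2 * ENNReal.ofReal (Real.exp (-(16 * L))))
      ≤ ((p ^ 2 : ℕ) : ENNReal) * (2 * ENNReal.ofReal (Real.exp (-(16 * L)))) := by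
        gcongr
    _ = ENNReal.ofReal ((p : ℝ) ^ 2 * (2 * Real.exp (-(16 * L)))) := by
        rw [ENNReal.ofReal_mul (by positivity), ENNReal.ofReal_mul (by norm_num)]
        congr 1
        · rw [← ENNReal.ofReal_natCast]; push_cast; rfl
        · simp
    _ ≤ _ := by
        refine ENNReal.ofReal_le_ofReal ?_
        have : (p : ℝ) ^ 2 * Real.exp (-(16 * L)) ≤ Real.exp (-L) := by
          rw [← e3, ← Real.exp_nat_mul, ← Real.exp_add]
          refine Real.exp_le_exp.2 ?_
          push_cast; linarith
        linarith

/-- The maximal inequality for weighted noise, at any dimension: when `log p` exceeds a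
multiple of the sample size, the rate exceeds a bound that the noise obeys for all weights at once. -/
theorem measure_pi_exists_noise_ge_rate_le {A : Type*} [Fintype A] (hm : m ≤ mΩ)
    [IsProbabilityMeasure P] (hεm : Measurable ε) (h : Psi2NormLE P ε K) (h0 : P[ε | m] =ᵐ[P] 0)
    {g : A → ι → (ι → Ω) → ℝ} (hgm : ∀ a i, Measurable (g a i))
    (hg : ∀ a i k s, Measurable[m] fun o => g a k (Function.update s i o))
    {c : ℝ} (hc : 0 < c) (hgc : ∀ a i s, |g a i s| ≤ c) {p : ℕ} (hp : 0 < p)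
    (hA : Fintype.card A ≤ p ^ 2) (hN : 0 < Fintype.card ι) :
    (Measure.pi fun _ : ι => P)
        {s | ∃ a, (Fintype.card ι : ℝ) * (8 * c * K * Real.sqrt (Real.log p / Fintype.card ι))
          ≤ |∑ i, g a i s * ε (s i)|}
      ≤ ENNReal.ofReal (2 * Real.exp (-Real.log p)
          + Real.exp (-(1 / 4) * (Fintype.card ι : ℝ))) := by
  have hN' : (0 : ℝ) < Fintype.card ι := by exact_mod_cast hN
  have hK := h.1
  rcases le_or_gt (16 * Real.log p) (Fintype.card ι) with hr | hr
  · refine (measure_pi_exists_ge_rate_le hm (fun _ => hεm) (fun _ => h) (fun _ => h0) hgm hg hc hgc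
      hp hA hN hr).trans (ENNReal.ofReal_le_ofReal ?_)
    linarith [Real.exp_pos (-(1 / 4) * (Fintype.card ι : ℝ))]
  · refine (measure_mono ?_).trans ((measure_pi_sum_sq_ge_le (ι := ι) hεm h).trans
      (ENNReal.ofReal_le_ofReal ?_))
    · rintro s ⟨a, ha⟩
      show 2 * (Fintype.card ι : ℝ) ≤ ∑ i, (ε (s i) / K) ^ 2
      set N : ℝ := (Fintype.card ι : ℝ) with hNdef
      have hsq : 1 / 4 ≤ Real.sqrt (Real.log p / N) := by
        refine Real.le_sqrt_of_sq_le ?_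
        rw [le_div_iff₀ hN']; linarith
      have h1 : |∑ i, g a i s * ε (s i)| ≤ ∑ i, c * K * ((1 + (ε (s i) / K) ^ 2) / 2) := by
        refine (Finset.abs_sum_le_sum_abs _ _).trans (Finset.sum_le_sum fun i _ => ?_)
        rw [abs_mul]
        have h2 : |ε (s i)| ≤ K * ((1 + (ε (s i) / K) ^ 2) / 2) := by
          have h3 : |ε (s i)| = K * |ε (s i) / K| := by
            rw [abs_div, abs_of_pos hK]; field_simp
          rw [h3, ← sq_abs]
          refine mul_le_mul_of_nonneg_left ?_ hK.le
          nlinarith [sq_nonneg (|ε (s i) / K| - 1)]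
        calc _ ≤ c * (K * ((1 + (ε (s i) / K) ^ 2) / 2)) := by
              gcongr; exact hgc a i s
          _ = _ := by ring
      rw [← Finset.mul_sum, ← Finset.sum_div, Finset.sum_add_distrib, Finset.sum_const,
        Finset.card_univ, nsmul_eq_mul, mul_one, ← hNdef] at h1
      have h4 : N * (8 * c * K * (1 / 4)) ≤ N * (8 * c * K * Real.sqrt (Real.log p / N)) := by
        gcongr
      have h5 := (h4.trans ha).trans h1
      have h6 : c * K * (2 * N) ≤ c * K * ((N + ∑ i, (ε (s i) / K) ^ 2) / 2) := by linarith
      have h7 := le_of_mul_le_mul_left h6 (by positivity)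
      linarith
    · linarith [Real.exp_pos (-Real.log p)]

end Maximal

/-! ### Concentration on one fold -/

section Fold

variable {p : ℕ} {P : Measure (Obs p)} [IsProbabilityMeasure P] {β θ : Fin p → ℝ} {B κ K : ℝ}
  {ι : Type*}

theorem measurable_comp_covarTreat_update [DecidableEq ι]
    {G : (ι → (Fin p → ℝ) × Bool) → ℝ} (hG : Measurable G)
    (s : ι → Obs p) (i : ι) :
    Measurable[MeasurableSpace.comap covarTreat inferInstance]
      fun o => G fun k => covarTreat (Function.update s i o k) := by
  have : (fun o => G fun k => covarTreat (Function.update s i o k))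
      = (fun z => G (Function.update (fun k => covarTreat (s k)) i z)) ∘ covarTreat := by
    funext o
    simp only [Function.comp_apply]
    congr 1
    funext k
    by_cases hk : k = i
    · subst hk; simp
    · simp [hk]
  rw [this]
  exact (hG.comp (measurable_update _)).comp (comap_measurable _)

theorem measurable_comp_covarTreat {G : (ι → (Fin p → ℝ) × Bool) → ℝ} (hG : Measurable G) :
    Measurable fun s : ι → Obs p => G fun k => covarTreat (s k) :=
  hG.comp (measurable_pi_lambda _ fun k => measurable_covarTreat.comp (measurable_pi_apply k))

theorem abs_balance_term_le {x θ : Fin p → ℝ} (w : Bool) (hB0 : 0 ≤ B) (hx : ∀ j, |x j| ≤ B)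
    (hθ : l1 θ ≤ κ) (j : Fin p) :
    |(1 - ind w * (1 + Real.exp (-dot x θ))) * x j| ≤ B * Real.exp (B * κ) := by
  have hκ : 0 ≤ κ := (l1_nonneg θ).trans hθ
  have h1 : Real.exp (-dot x θ) ≤ Real.exp (B * κ) := by
    have := (abs_le.1 (abs_dot_le (t := θ) hx)).1
    refine Real.exp_le_exp.2 ?_
    nlinarith
  have h2 : 1 ≤ Real.exp (B * κ) := Real.one_le_exp (by positivity)
  have h3 : |1 - ind w * (1 + Real.exp (-dot x θ))| ≤ Real.exp (B * κ) := by
    have := Real.exp_pos (-dot x θ)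
    cases w
    · simpa [ind] using h2
    · simp only [ind, if_true, abs_le]
      constructor <;> linarith
  rw [abs_mul, mul_comm]
  exact mul_le_mul (hx j) h3 (abs_nonneg _) hB0

variable [Fintype ι]

theorem ae_pi_abs_covar_le (hB : ∀ᵐ o ∂P, ∀ j, |covar o j| ≤ B) :
    ∀ᵐ d ∂(Measure.pi fun _ : ι => P), ∀ i j, |covar (d i) j| ≤ B := by
  rw [ae_all_iff]
  intro i
  exact (measurePreserving_eval (fun _ : ι => P) i).quasiMeasurePreserving.ae hB

variable [DecidableEq ι]

theorem condExp_bot_eq_zero {f : Obs p → ℝ} (h : ∫ o, f o ∂P = 0) :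
    P[f | ⊥] =ᵐ[P] 0 := by
  rw [condExp_bot, h]
  rfl

/-- The true weights balance the covariates at the rate `√(log p / N)`, at any dimension. -/
theorem measure_pi_balance_ge_le (hL : LinearLogistic P β θ)
    (hB : ∀ᵐ o ∂P, ∀ j, |covar o j| ≤ B) (hB0 : 0 < B) (hθ : l1 θ ≤ κ) (hp : 0 < p)
    (hN : 0 < Fintype.card ι) :
    (Measure.pi fun _ : ι => P) {d | ∃ j, 16 * B * Real.exp (B * κ)
        * Real.sqrt (Real.log p / Fintype.card ι) ≤ |balance (fun i => covarTreat (d i)) θ j|}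
      ≤ ENNReal.ofReal (2 * Real.exp (-Real.log p)) := by
  have hN' : (0 : ℝ) < Fintype.card ι := by exact_mod_cast hN
  set M := Real.exp (B * κ) with hM
  have hM0 : 0 < M := Real.exp_pos _
  set f : Fin p → Obs p → ℝ := fun j o =>
    (1 - ind (treat o) * (1 + Real.exp (-dot (covar o) θ))) * covar o j with hf
  have hfm : ∀ j, Measurable (f j) := fun j =>
    (measurable_const.sub ((measurable_ind.comp measurable_treat).mul
      (measurable_const.add
        (((measurable_dot θ).comp measurable_covar).neg.exp)))).mul
      ((measurable_pi_apply j).comp measurable_covar)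
  have hfb : ∀ j, ∀ᵐ o ∂P, |f j o| ≤ B * M := fun j => by
    filter_upwards [hB] with o ho using abs_balance_term_le _ hB0.le ho hθ j
  have hbal : ∀ (d : ι → Obs p) j, |balance (fun i => covarTreat (d i)) θ j|
      = (1 / (Fintype.card ι : ℝ)) * |∑ i, f j (d i)| := by
    intro d j
    unfold balance
    rw [abs_mul, abs_of_nonneg (by positivity)]
    rfl
  rcases le_or_gt (16 * Real.log p) (Fintype.card ι) with hr | hr
  · refine (measure_mono ?_).trans (measure_pi_exists_ge_rate_le (ι := ι) (m := ⊥) bot_le hfm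
      (fun j => psi2NormLE_of_abs_le (by positivity) (hfb j))
      (fun j => condExp_bot_eq_zero (integral_balance_eq_zero hL hB j))
      (g := fun _ _ _ => 1) (fun _ _ => measurable_const) (fun _ _ _ _ => measurable_const)
      one_pos (fun _ _ _ => by simp) hp (by simp; nlinarith) hN hr)
    rintro d ⟨j, hj⟩
    refine ⟨j, ?_⟩
    rw [hbal, one_div, le_inv_mul_iff₀ hN'] at hj
    simp only [one_mul]
    refine le_trans (le_of_eq ?_) hj
    ring
  · refine le_trans (le_of_eq ?_) (zero_le (a := ENNReal.ofReal (2 * Real.exp (-Real.log p))))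
    refine measure_mono_null ?_ (ae_pi_abs_covar_le (ι := ι) hB)
    rintro d ⟨j, hj⟩ hall
    have h1 : |∑ i, f j (d i)| ≤ Fintype.card ι * (B * M) := by
      refine (Finset.abs_sum_le_sum_abs _ _).trans ((Finset.sum_le_sum fun i _ =>
        abs_balance_term_le (treat (d i)) hB0.le (hall i) hθ j).trans (le_of_eq ?_))
      rw [Finset.sum_const, Finset.card_univ, nsmul_eq_mul]
    rw [hbal, one_div, le_inv_mul_iff₀ hN'] at hj
    have hsq : 1 / 4 ≤ Real.sqrt (Real.log p / Fintype.card ι) := by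
      refine Real.le_sqrt_of_sq_le ?_
      rw [le_div_iff₀ hN']; linarith
    have h3 := le_of_mul_le_mul_left (hj.trans h1) hN'
    have h4 : 16 * B * M * (1 / 4) ≤ 16 * B * M * Real.sqrt (Real.log p / Fintype.card ι) := by
      gcongr
    have h5 : 0 < B * M := by positivity
    linarith

/-- Entrywise concentration of the Gram matrix of the treated units. -/
theorem measure_pi_treatedGram_ge_le (hB : ∀ᵐ o ∂P, ∀ j, |covar o j| ≤ B) (hB0 : 0 < B)
    (hp : 0 < p) (hN : 0 < Fintype.card ι) (hrate : 16 * Real.log p ≤ Fintype.card ι) :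
    (Measure.pi fun _ : ι => P) {d | ∃ a : Fin p × Fin p, (Fintype.card ι : ℝ) * (32 * B ^ 2
        * Real.sqrt (Real.log p / Fintype.card ι))
        ≤ |∑ i, (ind (treat (d i)) * (covar (d i) a.1 * covar (d i) a.2)
            - treatedGram P a.1 a.2)|}
      ≤ ENNReal.ofReal (2 * Real.exp (-Real.log p)) := by
  set f : Fin p × Fin p → Obs p → ℝ := fun a o =>
    ind (treat o) * (covar o a.1 * covar o a.2) - treatedGram P a.1 a.2 with hf
  have hfm : ∀ a, Measurable (f a) := fun a =>
    ((measurable_ind.comp measurable_treat).mul (((measurable_pi_apply a.1).comp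
      measurable_covar).mul ((measurable_pi_apply a.2).comp measurable_covar))).sub
      measurable_const
  have hpt : ∀ a : Fin p × Fin p, ∀ᵐ o ∂P,
      |ind (treat o) * (covar o a.1 * covar o a.2)| ≤ B ^ 2 := by
    intro a
    filter_upwards [hB] with o ho
    rw [abs_mul, abs_mul, abs_of_nonneg (ind_nonneg _)]
    have h1 := mul_le_mul (ho a.1) (ho a.2) (abs_nonneg _) hB0.le
    have h2 : 0 ≤ |covar o a.1| * |covar o a.2| := by positivity
    nlinarith [ind_le_one (treat o), ind_nonneg (treat o)]
  have hG : ∀ a : Fin p × Fin p, |treatedGram P a.1 a.2| ≤ B ^ 2 := by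
    intro a
    have := norm_integral_le_of_norm_le_const (μ := P)
      (f := fun o => ind (treat o) * (covar o a.1 * covar o a.2)) (hpt a)
    simpa [treatedGram] using this
  have hfb : ∀ a, ∀ᵐ o ∂P, |f a o| ≤ 2 * B ^ 2 := fun a => by
    filter_upwards [hpt a] with o ho
    refine (abs_sub _ _).trans ?_
    linarith [hG a]
  have hf0 : ∀ a, ∫ o, f a o ∂P = 0 := fun a => by
    rw [integral_sub (integrable_ind_mul_covar_mul hB a.1 a.2) (integrable_const _)]
    simp [treatedGram]
  refine (measure_mono ?_).trans (measure_pi_exists_ge_rate_le (ι := ι) (m := ⊥) bot_le hfm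
    (fun a => psi2NormLE_of_abs_le (by positivity) (hfb a))
    (fun a => condExp_bot_eq_zero (hf0 a))
    (g := fun _ _ _ => 1) (fun _ _ => measurable_const) (fun _ _ _ _ => measurable_const)
    one_pos (fun _ _ _ => by simp) hp (by simp [sq]) hN hrate)
  rintro d ⟨a, ha⟩
  refine ⟨a, ?_⟩
  simp only [one_mul]
  refine le_trans (le_of_eq ?_) ha
  ring

end Fold

/-! ### The good event of one fold -/

section FoldBound

variable {p : ℕ} {P : Measure (Obs p)} [IsProbabilityMeasure P] {β θ : Fin p → ℝ} {B κ K : ℝ}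
  {ι : Type*}

/-- The propensity estimate computed from the covariates and treatments of a sample. -/
def propEstimate (T : (ι → (Fin p → ℝ) × Bool) → Fin p → ℝ) (d : ι → Obs p) : Fin p → ℝ :=
  T fun i => covarTreat (d i)

/-- The change of the weight of a treated unit when `θ` is replaced by its estimate. -/
def weightError (θ : Fin p → ℝ) (T : (ι → (Fin p → ℝ) × Bool) → Fin p → ℝ) (i : ι)
    (D : ι → (Fin p → ℝ) × Bool) : ℝ :=
  ind (D i).2 * (Real.exp (-dot (D i).1 (T D)) - Real.exp (-dot (D i).1 θ))

theorem measurable_dot_apply {T : (ι → (Fin p → ℝ) × Bool) → Fin p → ℝ} (hT : Measurable T)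
    (i : ι) : Measurable fun D => dot (D i).1 (T D) := by
  unfold dot; fun_prop

theorem measurable_weightError {T : (ι → (Fin p → ℝ) × Bool) → Fin p → ℝ} (hT : Measurable T)
    (i : ι) : Measurable (weightError θ T i) :=
  (measurable_ind.comp (measurable_snd.comp (measurable_pi_apply i))).mul
    ((measurable_dot_apply hT i).neg.exp.sub
      (measurable_dot_apply measurable_const i).neg.exp)

variable [Fintype ι]

/-- If the Gram matrix of the treated units is entrywise within `τ` of its mean, then its quadratic
form loses at most `τ ‖h‖₁²`. -/
theorem sum_treated_sq_ge_of_treatedGram_close (hL : LinearLogistic P β θ)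
    (hB : ∀ᵐ o ∂P, ∀ j, |covar o j| ≤ B) {cmin cmax : ℝ} (hE : EigenvalueAssumption P cmin cmax)
    (hB0 : 0 ≤ B) (hθ : l1 θ ≤ κ) (hN : 0 < Fintype.card ι) {d : ι → Obs p} {τ : ℝ}
    (hclose : ∀ j k, |∑ i, (ind (treat (d i)) * (covar (d i) j * covar (d i) k)
      - treatedGram P j k)| ≤ Fintype.card ι * τ) (h : Fin p → ℝ) :
    cmin / (1 + Real.exp (B * κ)) * ∑ j, h j ^ 2 - τ * l1 h ^ 2
      ≤ (1 / (Fintype.card ι : ℝ)) * ∑ i, ind (treat (d i)) * dot (covar (d i)) h ^ 2 := by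
  have hN' : (0 : ℝ) < Fintype.card ι := by exact_mod_cast hN
  have h1 := le_sum_treatedGram hL hB hE hB0 hθ h
  rw [one_div, le_inv_mul_iff₀ hN']
  have e1 : ∑ i, ind (treat (d i)) * dot (covar (d i)) h ^ 2
      = ∑ j, ∑ k, h j * h k * ∑ i, (ind (treat (d i)) * (covar (d i) j * covar (d i) k)
          - treatedGram P j k)
        + Fintype.card ι * ∑ j, ∑ k, h j * h k * treatedGram P j k := by
    have e2 : ∀ i, ind (treat (d i)) * dot (covar (d i)) h ^ 2
        = ∑ j, ∑ k, h j * h k * (ind (treat (d i)) * (covar (d i) j * covar (d i) k)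
          - treatedGram P j k) + ∑ j, ∑ k, h j * h k * treatedGram P j k := by
      intro i
      rw [dot_sq_eq, Finset.mul_sum, ← Finset.sum_add_distrib]
      refine Finset.sum_congr rfl fun j _ => ?_
      rw [Finset.mul_sum, ← Finset.sum_add_distrib]
      exact Finset.sum_congr rfl fun k _ => by ring
    rw [Finset.sum_congr rfl fun i _ => e2 i, Finset.sum_add_distrib, Finset.sum_const,
      Finset.card_univ, nsmul_eq_mul, Finset.sum_comm]
    congr 1
    refine Finset.sum_congr rfl fun j _ => ?_
    rw [Finset.sum_comm]
    exact Finset.sum_congr rfl fun k _ => (Finset.mul_sum _ _ _).symm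
  have e3 : -(Fintype.card ι * τ * l1 h ^ 2)
      ≤ ∑ j, ∑ k, h j * h k * ∑ i, (ind (treat (d i)) * (covar (d i) j * covar (d i) k)
          - treatedGram P j k) := by
    have e4 : Fintype.card ι * τ * l1 h ^ 2
        = ∑ j, ∑ k, |h j| * |h k| * (Fintype.card ι * τ) := by
      unfold l1
      rw [sq, Finset.sum_mul_sum, Finset.mul_sum]
      refine Finset.sum_congr rfl fun j _ => ?_
      rw [Finset.mul_sum]
      exact Finset.sum_congr rfl fun k _ => by ring
    rw [e4, ← Finset.sum_neg_distrib]
    refine Finset.sum_le_sum fun j _ => ?_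
    rw [← Finset.sum_neg_distrib]
    refine Finset.sum_le_sum fun k _ => ?_
    refine neg_le_of_abs_le ?_
    rw [abs_mul, abs_mul]
    exact mul_le_mul_of_nonneg_left (hclose j k) (by positivity)
  rw [e1]
  have e5 := mul_le_mul_of_nonneg_left h1 hN'.le
  nlinarith

/-- The properties of one fold that drive the expansion: the noise picked up by the estimated
weights is below `δ √N`, the estimated weights balance the covariates up to `lamθ`, and the lasso
error is at most `R` in `ℓ₁`-norm. -/
def FoldGood (β θ : Fin p → ℝ) (T : (ι → (Fin p → ℝ) × Bool) → Fin p → ℝ)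
    (lamθ lamβ δ R : ℝ) (d : ι → Obs p) : Prop :=
  |∑ i, weightError θ T i (fun k => covarTreat (d k)) * resid β (d i)|
      < δ * Real.sqrt (Fintype.card ι) ∧
    (∀ j, |balance (fun i => covarTreat (d i)) (propEstimate T d) j| ≤ lamθ) ∧
    ∀ b, IsMinOn (outcomeLoss d (propEstimate T d) lamβ) Set.univ b → l1 (b - β) ≤ R

variable [DecidableEq ι]

/-- The noise of the weighted lasso, whose weights are estimated on the same fold. -/
theorem measure_pi_lasso_noise_le (hL : LinearLogistic P β θ)
    (hB : ∀ᵐ o ∂P, ∀ j, |covar o j| ≤ B) (hB0 : 0 < B) (hψ : Psi2NormLE P (resid β) K)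
    (hp : 0 < p) (hN : 0 < Fintype.card ι) {T : (ι → (Fin p → ℝ) × Bool) → Fin p → ℝ}
    (hT : Measurable T) :
    (Measure.pi fun _ : ι => P) {d | (∀ i j, |covar (d i) j| ≤ B) ∧ l1 (propEstimate T d) ≤ κ ∧
        ∃ j, 8 * (B * Real.exp (B * κ)) * K * Real.sqrt (Real.log p / Fintype.card ι)
          ≤ |(1 / (Fintype.card ι : ℝ)) * ∑ i, ind (treat (d i)) *
            Real.exp (-dot (covar (d i)) (propEstimate T d)) * covar (d i) j * resid β (d i)|}
      ≤ ENNReal.ofReal (2 * Real.exp (-Real.log p)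
          + Real.exp (-(1 / 4) * (Fintype.card ι : ℝ))) := by
  have hN' : (0 : ℝ) < Fintype.card ι := by exact_mod_cast hN
  set c := B * Real.exp (B * κ) with hc
  have hc0 : 0 < c := by positivity
  have hεm := measurable_resid (p := p) β
  have hε := hψ.integrable hεm
  -- the weights, clipped to the range where they lie with high probability
  set G : Fin p → ι → (ι → (Fin p → ℝ) × Bool) → ℝ := fun j i D =>
    max (-c) (min c (ind (D i).2 * Real.exp (-dot (D i).1 (T D)) * (D i).1 j)) with hG
  have hGm : ∀ j i, Measurable (G j i) := fun j i =>
    measurable_const.max (measurable_const.min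
      (((measurable_ind.comp (measurable_snd.comp (measurable_pi_apply i))).mul
        (measurable_dot_apply hT i).neg.exp).mul
          ((measurable_pi_apply j).comp (measurable_fst.comp (measurable_pi_apply i)))))
  refine (measure_mono ?_).trans (measure_pi_exists_noise_ge_rate_le (ι := ι)
    measurable_covarTreat.comap_le hεm hψ (condExp_resid_covarTreat hL hB hε)
    (g := fun j i s => G j i fun k => covarTreat (s k))
    (fun j i => measurable_comp_covarTreat (hGm j i))
    (fun j i k s => measurable_comp_covarTreat_update (hGm j k) s i) hc0
    (fun j i s => abs_le.2 ⟨le_max_left _ _, max_le (by linarith) (min_le_left _ _)⟩)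
    hp (by simp; nlinarith) hN)
  rintro d ⟨hX, hκ, j, hj⟩
  refine ⟨j, ?_⟩
  have hval : ∀ i, G j i (fun k => covarTreat (d k)) = ind (treat (d i)) *
      Real.exp (-dot (covar (d i)) (propEstimate T d)) * covar (d i) j := by
    intro i
    have h1 : |ind (treat (d i)) *
        Real.exp (-dot (covar (d i)) (propEstimate T d)) * covar (d i) j| ≤ c := by
      have e1 := (abs_le.1 (abs_dot_le (t := propEstimate T d) (hX i))).1
      have e2 : Real.exp (-dot (covar (d i)) (propEstimate T d)) ≤ Real.exp (B * κ) :=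
        Real.exp_le_exp.2 (by nlinarith)
      rw [abs_mul, abs_mul, abs_of_nonneg (ind_nonneg _), abs_of_pos (Real.exp_pos _), hc,
        mul_comm B]
      refine mul_le_mul ?_ (hX i j) (abs_nonneg _) (Real.exp_pos _).le
      have e3 := ind_le_one (treat (d i))
      have e4 := Real.exp_pos (-dot (covar (d i)) (propEstimate T d))
      nlinarith
    show max (-c) (min c (ind (treat (d i)) *
      Real.exp (-dot (covar (d i)) (propEstimate T d)) * covar (d i) j)) = _
    rw [min_eq_right (abs_le.1 h1).2, max_eq_right (abs_le.1 h1).1]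
  simp only [hval]
  rw [abs_mul, abs_of_nonneg (by positivity), one_div, le_inv_mul_iff₀ hN'] at hj
  exact hj

/-- The noise picked up by the estimation error of the weights, when this error is small in mean
square. -/
theorem measure_pi_weightError_noise_le (hL : LinearLogistic P β θ)
    (hB : ∀ᵐ o ∂P, ∀ j, |covar o j| ≤ B) (hψ : Psi2NormLE P (resid β) K)
    (hN : 0 < Fintype.card ι) {T : (ι → (Fin p → ℝ) × Bool) → Fin p → ℝ}
    (hT : Measurable T) {M η δ : ℝ} (hM : 0 ≤ M) (hη : 0 < η) (hδ : 0 < δ) :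
    (Measure.pi fun _ : ι => P) {d |
        ((∑ i, weightError θ T i (fun k => covarTreat (d k)) ^ 2 ≤ Fintype.card ι * η) ∧
          ∀ i, |weightError θ T i (fun k => covarTreat (d k))| ≤ M) ∧
        δ * Real.sqrt (Fintype.card ι)
          ≤ |∑ i, weightError θ T i (fun k => covarTreat (d k)) * resid β (d i)|}
      ≤ ENNReal.ofReal (Real.sqrt η * (M ^ 2 + 4 * K ^ 4) / δ ^ 2) := by
  classical
  have hεm := measurable_resid (p := p) β
  have hε := hψ.integrable hεm
  set E : Set (ι → (Fin p → ℝ) × Bool) := {D | (∑ i, weightError θ T i D ^ 2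
    ≤ Fintype.card ι * η) ∧ ∀ i, |weightError θ T i D| ≤ M} with hE
  have hw := fun i => measurable_weightError (θ := θ) hT i
  have hEm : MeasurableSet E := by
    refine (measurableSet_le (Finset.measurable_fun_sum _ fun i _ => (hw i).pow_const 2)
      measurable_const).inter ?_
    show MeasurableSet {D | ∀ i, |weightError θ T i D| ≤ M}
    rw [Set.ofPred_forall]
    exact MeasurableSet.iInter fun i => measurableSet_le (hw i).abs measurable_const
  set G : ι → (ι → (Fin p → ℝ) × Bool) → ℝ := fun i => E.indicator (weightError θ T i) with hG
  have hGm : ∀ i, Measurable (G i) := fun i => (hw i).indicator hEm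
  refine (measure_mono ?_).trans (measure_pi_abs_sum_mul_ge_sqrt_le (ι := ι)
    measurable_covarTreat.comap_le hεm hψ (condExp_resid_covarTreat hL hB hε)
    (g := fun i s => G i fun k => covarTreat (s k))
    (fun i => measurable_comp_covarTreat (hGm i))
    (fun i k s => measurable_comp_covarTreat_update (hGm k) s i) (c := M)
    (fun i s => ?_) hη hδ (fun s => ?_) hN)
  · rintro d ⟨hd, hge⟩
    have hmem : (fun k => covarTreat (d k)) ∈ E := hd
    show _ ≤ |∑ i, E.indicator (weightError θ T i) (fun k => covarTreat (d k)) * resid β (d i)|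
    simp only [Set.indicator_of_mem hmem]
    exact hge
  · by_cases h : (fun k => covarTreat (s k)) ∈ E
    · simp only [hG, Set.indicator_of_mem h]
      exact h.2 i
    · simp only [hG, Set.indicator_of_notMem h, abs_zero, hM]
  · by_cases h : (fun k => covarTreat (s k)) ∈ E
    · simp only [hG, Set.indicator_of_mem h]
      exact h.1
    · simp only [hG, Set.indicator_of_notMem h]
      simp; positivity

/-- A fold is good with high probability. The alternatives in `hηθ` and `hs` single out zero
parameters, for which nothing is known about `log p / N`. -/
theorem measure_pi_not_foldGood_le (hL : LinearLogistic P β θ)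
    (hB : ∀ᵐ o ∂P, ∀ j, |covar o j| ≤ B) (hB0 : 0 < B) (hψ : Psi2NormLE P (resid β) K)
    {cmin cmax : ℝ} (hE : EigenvalueAssumption P cmin cmax) (hcmin : 0 < cmin) (hθ : l1 θ ≤ κ)
    (hp : 2 ≤ p) (hN : 0 < Fintype.card ι) {lamθ lamβ η δ : ℝ} {cG : ℝ}
    (hcG : cG = cmin / (1 + Real.exp (B * κ)))
    {T : (ι → (Fin p → ℝ) × Bool) → Fin p → ℝ} (hT : Measurable T)
    (hTout : ∀ D, IsPropensityOutput D lamθ κ (T D))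
    (hlamθ : 32 * B * Real.exp (B * κ) * Real.sqrt (Real.log p / Fintype.card ι) ≤ lamθ)
    (hlamβ : 32 * B * Real.exp (B * κ) * K * Real.sqrt (Real.log p / Fintype.card ι) ≤ lamβ)
    (hη : 0 < η) (hδ : 0 < δ) (hηθ : θ = 0 ∨ 3 * κ * Real.exp (B * κ) * lamθ ≤ η)
    (hs : l0 β = 0 ∨ (16 * Real.log p ≤ Fintype.card ι ∧
      32 * (32 * B ^ 2 * Real.sqrt (Real.log p / Fintype.card ι)) * l0 β ≤ cG)) :
    (Measure.pi fun _ : ι => P) {d | ¬ FoldGood β θ T lamθ lamβ δ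
        (12 * l0 β * lamβ / ((Real.exp (B * κ))⁻¹ * cG)) d}
      ≤ ENNReal.ofReal (6 * Real.exp (-Real.log p) + Real.exp (-(1 / 4) * (Fintype.card ι : ℝ))
          + Real.sqrt η * (Real.exp (B * κ) ^ 2 + 4 * K ^ 4) / δ ^ 2) := by
  have hN' : (0 : ℝ) < Fintype.card ι := by exact_mod_cast hN
  have hp0 : 0 < p := by omega
  have hκ : 0 ≤ κ := (l1_nonneg θ).trans hθ
  have hK := hψ.1
  have hlogp : 0 < Real.log p := Real.log_pos (by exact_mod_cast hp)
  set M := Real.exp (B * κ) with hM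
  have hM0 : 0 < M := Real.exp_pos _
  set ρ := Real.sqrt (Real.log p / Fintype.card ι) with hρ
  have hρ0 : 0 < ρ := Real.sqrt_pos.2 (by positivity)
  have hlamθ0 : 0 < lamθ := lt_of_lt_of_le (by positivity) hlamθ
  have hlamβ0 : 0 < lamβ := lt_of_lt_of_le (by positivity) hlamβ
  have hcG0 : 0 < cG := by rw [hcG]; positivity
  set E0 : Set (ι → Obs p) := {d | ¬ ∀ i j, |covar (d i) j| ≤ B} with hE0
  set E1 : Set (ι → Obs p) := {d | ∃ j, 16 * B * M * ρ
    ≤ |balance (fun i => covarTreat (d i)) θ j|} with hE1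
  set E2 : Set (ι → Obs p) := {d | (∀ i j, |covar (d i) j| ≤ B) ∧ l1 (propEstimate T d) ≤ κ ∧
        ∃ j, 8 * (B * M) * K * ρ
          ≤ |(1 / (Fintype.card ι : ℝ)) * ∑ i, ind (treat (d i)) *
            Real.exp (-dot (covar (d i)) (propEstimate T d)) * covar (d i) j * resid β (d i)|}
    with hE2
  set E3 : Set (ι → Obs p) := {d | 16 * Real.log p ≤ Fintype.card ι ∧
    ∃ a : Fin p × Fin p, (Fintype.card ι : ℝ) * (32 * B ^ 2 * ρ)
        ≤ |∑ i, (ind (treat (d i)) * (covar (d i) a.1 * covar (d i) a.2)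
            - treatedGram P a.1 a.2)|} with hE3
  set E4 : Set (ι → Obs p) := {d |
        ((∑ i, weightError θ T i (fun k => covarTreat (d k)) ^ 2 ≤ Fintype.card ι * η) ∧
          ∀ i, |weightError θ T i (fun k => covarTreat (d k))| ≤ M) ∧
        δ * Real.sqrt (Fintype.card ι)
          ≤ |∑ i, weightError θ T i (fun k => covarTreat (d k)) * resid β (d i)|} with hE4
  set μ := Measure.pi fun _ : ι => P with hμ
  have m0 : μ E0 = 0 := ae_pi_abs_covar_le (ι := ι) hB
  have m1 : μ E1 ≤ ENNReal.ofReal (2 * Real.exp (-Real.log p)) :=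
    measure_pi_balance_ge_le hL hB hB0 hθ hp0 hN
  have m2 : μ E2 ≤ ENNReal.ofReal (2 * Real.exp (-Real.log p)
          + Real.exp (-(1 / 4) * (Fintype.card ι : ℝ))) :=
    measure_pi_lasso_noise_le hL hB hB0 hψ hp0 hN hT
  have m3 : μ E3 ≤ ENNReal.ofReal (2 * Real.exp (-Real.log p)) := by
    by_cases hr : 16 * Real.log p ≤ Fintype.card ι
    · exact (measure_mono fun d hd => hd.2).trans (measure_pi_treatedGram_ge_le hB hB0 hp0 hN hr)
    · have : E3 = ∅ := by
        ext d; simp only [hE3, Set.mem_ofPred_eq, hr, false_and, Set.mem_empty_iff_false]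
      rw [this]; simp
  have m4 : μ E4 ≤ ENNReal.ofReal (Real.sqrt η * (M ^ 2 + 4 * K ^ 4) / δ ^ 2) :=
    measure_pi_weightError_noise_le hL hB hψ hN hT hM0.le hη hδ
  have hsub : {d | ¬ FoldGood β θ T lamθ lamβ δ (12 * l0 β * lamβ / (M⁻¹ * cG)) d}
      ⊆ E0 ∪ (E1 ∪ (E2 ∪ (E3 ∪ E4))) := by
    intro d hd
    by_contra hcon
    simp only [Set.mem_union, not_or] at hcon
    obtain ⟨n0, n1, n2, n3, n4⟩ := hcon
    apply hd
    have hX : ∀ i j, |covar (d i) j| ≤ B := not_not.1 n0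
    have hbθ : ∀ j, |balance (fun i => covarTreat (d i)) θ j| ≤ lamθ / 2 := fun j => by
      have : ¬ 16 * B * M * ρ ≤ _ := fun hh => n1 ⟨j, hh⟩
      linarith [not_le.1 this]
    obtain ⟨ht1, ht2, ht3⟩ := (hTout fun i => covarTreat (d i)).spec hlamθ0 hθ hbθ
    change l1 (propEstimate T d) ≤ κ at ht1
    have hexp : ∀ i (t : Fin p → ℝ), l1 t ≤ κ → |dot (covar (d i)) t| ≤ B * κ := fun i t ht =>
      (abs_dot_le (hX i)).trans (by gcongr)
    refine ⟨?_, ht2, ?_⟩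
    · by_contra hge
      rw [not_lt] at hge
      refine n4 ⟨⟨?_, ?_⟩, hge⟩
      · rcases hηθ with h0 | hle
        · have hz : ∀ i, weightError θ T i (fun k => covarTreat (d k)) = 0 := fun i => by
            unfold weightError; rw [ht3 h0, h0]; simp
          simp only [hz]
          simp; positivity
        · have := sum_treated_sq_exp_sub_le hB0.le (d := fun i => covarTreat (d i))
            (t := T fun i => covarTreat (d i)) hX hθ ht1 hbθ ht2 hlamθ0.le
          refine le_trans (le_of_eq ?_) (this.trans (mul_le_mul_of_nonneg_left hle hN'.le))
          refine Finset.sum_congr rfl fun i _ => ?_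
          unfold weightError
          rw [mul_pow, ind_sq]
      · intro i
        unfold weightError
        rw [abs_mul, abs_of_nonneg (ind_nonneg _)]
        have e1 : Real.exp (-dot (covar (d i)) (propEstimate T d)) ≤ M :=
          Real.exp_le_exp.2 (by linarith [(abs_le.1 (hexp i _ ht1)).1])
        have e2 : Real.exp (-dot (covar (d i)) θ) ≤ M :=
          Real.exp_le_exp.2 (by linarith [(abs_le.1 (hexp i _ hθ)).1])
        have e3 : |Real.exp (-dot (covar (d i)) (propEstimate T d))
            - Real.exp (-dot (covar (d i)) θ)| ≤ M := by
          rw [abs_le]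
          constructor <;> linarith [Real.exp_pos (-dot (covar (d i)) (propEstimate T d)),
            Real.exp_pos (-dot (covar (d i)) θ)]
        calc _ ≤ 1 * M := mul_le_mul (ind_le_one _) e3 (abs_nonneg _) zero_le_one
          _ = M := one_mul M
    · intro b hb
      have hnoise : ∀ j, |(1 / (Fintype.card ι : ℝ)) * ∑ i, ind (treat (d i)) *
          Real.exp (-dot (covar (d i)) (propEstimate T d)) * covar (d i) j * resid β (d i)|
          ≤ lamβ / 4 := fun j => by
        have : ¬ 8 * (B * M) * K * ρ ≤ _ := fun hh => n2 ⟨hX, ht1, j, hh⟩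
        linarith [not_le.1 this]
      have hω : ∀ i, M⁻¹ ≤ Real.exp (-dot (covar (d i)) (propEstimate T d)) := fun i => by
        rw [hM, ← Real.exp_neg]
        exact Real.exp_le_exp.2 (by linarith [(abs_le.1 (hexp i _ ht1)).2])
      rcases hs with h0 | ⟨hr, hτ⟩
      · -- a zero truth: the cone condition alone forces a zero error, whatever the Gram matrix
        refine lasso_l1_error_le (τ := cG) hlamβ0 hb hnoise (by positivity) hω (fun h => ?_)
          hcG0 hcG0.le (by rw [h0]; simp; exact hcG0.le)
        have e1 : ∑ j, h j ^ 2 ≤ l1 h ^ 2 := by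
          have := Finset.sum_sq_le_sq_sum_of_nonneg (s := Finset.univ)
            (f := fun j => |h j|) fun j _ => abs_nonneg _
          simpa [l1, sq_abs] using this
        have e2 : 0 ≤ (1 / (Fintype.card ι : ℝ)) *
            ∑ i, ind (treat (d i)) * dot (covar (d i)) h ^ 2 :=
          mul_nonneg (by positivity) (Finset.sum_nonneg fun i _ =>
            mul_nonneg (ind_nonneg _) (sq_nonneg _))
        nlinarith
      · refine lasso_l1_error_le (τ := 32 * B ^ 2 * ρ) hlamβ0 hb hnoise (by positivity) hω ?_
          hcG0 (by positivity) hτ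
        rw [hcG]
        refine sum_treated_sq_ge_of_treatedGram_close hL hB hE hB0.le hθ hN fun j k => ?_
        by_contra hlt
        exact n3 ⟨hr, (j, k), (not_le.1 hlt).le⟩
  calc μ _ ≤ μ (E0 ∪ (E1 ∪ (E2 ∪ (E3 ∪ E4)))) := measure_mono hsub
    _ ≤ μ E0 + (μ E1 + (μ E2 + (μ E3 + μ E4))) := by
        refine (measure_union_le _ _).trans ?_
        gcongr
        refine (measure_union_le _ _).trans ?_
        gcongr
        refine (measure_union_le _ _).trans ?_
        gcongr
        exact measure_union_le _ _
    _ ≤ 0 + (ENNReal.ofReal (2 * Real.exp (-Real.log p))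
          + (ENNReal.ofReal (2 * Real.exp (-Real.log p)
              + Real.exp (-(1 / 4) * (Fintype.card ι : ℝ)))
            + (ENNReal.ofReal (2 * Real.exp (-Real.log p))
              + ENNReal.ofReal (Real.sqrt η * (M ^ 2 + 4 * K ^ 4) / δ ^ 2)))) := by
        rw [m0]; gcongr
    _ = _ := by
        rw [zero_add, ← ENNReal.ofReal_add (by positivity) (by positivity),
          ← ENNReal.ofReal_add (by positivity) (by positivity),
          ← ENNReal.ofReal_add (by positivity) (by positivity)]
        congr 1; ring

end FoldBound

/-! ### Expansion of the cross-fitted estimate -/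

section Expansion

variable {p : ℕ} {P : Measure (Obs p)} {β θ : Fin p → ℝ}

/-- The exact expansion of the mean estimate of one fold. -/
theorem foldMean_eq {ι : Type*} [Fintype ι] (β θ : Fin p → ℝ)
    (T : (ι → (Fin p → ℝ) × Bool) → Fin p → ℝ) (d : ι → Obs p) (b : Fin p → ℝ) :
    foldMean d (propEstimate T d) b
      = (1 / (Fintype.card ι : ℝ)) * ∑ i, (ind (treat (d i)) * resid β (d i)
            * q (dot (covar (d i)) θ) + dot (covar (d i)) β)
        + ((1 / (Fintype.card ι : ℝ)) *
            ∑ i, weightError θ T i (fun k => covarTreat (d k)) * resid β (d i)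
          + ∑ j, balance (fun i => covarTreat (d i)) (propEstimate T d) j * (b - β) j) := by
  rw [sum_balance_mul]
  unfold foldMean
  rw [← mul_add, ← mul_add, ← Finset.sum_add_distrib, ← Finset.sum_add_distrib]
  congr 1
  refine Finset.sum_congr rfl fun i _ => ?_
  have h1 := ind_mul_outcome (d i)
  have h2 : weightError θ T i (fun k => covarTreat (d k)) = ind (treat (d i)) *
      (Real.exp (-dot (covar (d i)) (propEstimate T d)) - Real.exp (-dot (covar (d i)) θ)) := rfl
  rw [h2]
  simp only [covarTreat]
  rw [dot_sub]
  unfold resid q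
  linear_combination (1 + Real.exp (-dot (covar (d i)) (propEstimate T d))) * h1

/-- On good folds the error of the expansion is bounded deterministically. Here `h` and `hc` pair
the propensity estimate of one fold with the outcome estimate of the other. -/
theorem abs_expansion_error_le {n N : ℕ} (hn : n = 2 * N) (hN : 0 < N) (s : Fin n → Obs p)
    {J : Finset (Fin n)} (hJ : J.card = N) (hJc : Jᶜ.card = N)
    {T : (J → (Fin p → ℝ) × Bool) → Fin p → ℝ}
    {Tc : ((Jᶜ : Finset (Fin n)) → (Fin p → ℝ) × Bool) → Fin p → ℝ} {b bc : Fin p → ℝ}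
    {lamθ lamβ δ R : ℝ} (hlam : 0 ≤ lamθ)
    (h : FoldGood β θ T lamθ lamβ δ R (restrictTo s J))
    (hc : FoldGood β θ Tc lamθ lamβ δ R (restrictTo s Jᶜ))
    (hb : IsMinOn (outcomeLoss (restrictTo s J) (propEstimate T (restrictTo s J)) lamβ)
      Set.univ b)
    (hbc : IsMinOn (outcomeLoss (restrictTo s Jᶜ) (propEstimate Tc (restrictTo s Jᶜ)) lamβ)
      Set.univ bc) :
    |Real.sqrt (n : ℝ) * (muHat s J (propEstimate T (restrictTo s J))
        (propEstimate Tc (restrictTo s Jᶜ)) b bc - mu1 P) - linearTerm P β θ s|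
      ≤ Real.sqrt 2 * δ + Real.sqrt (n : ℝ) * (lamθ * R) := by
  obtain ⟨h1, h2, h3⟩ := h
  obtain ⟨c1, c2, c3⟩ := hc
  have hN' : (0 : ℝ) < N := by exact_mod_cast hN
  have hn' : (n : ℝ) = 2 * N := by rw [hn]; push_cast; ring
  have hsN : 0 < Real.sqrt N := Real.sqrt_pos.2 hN'
  have hsn : Real.sqrt n = Real.sqrt 2 * Real.sqrt N := by
    rw [hn', Real.sqrt_mul (by norm_num)]
  have hs0 : 0 < Real.sqrt (n : ℝ) := Real.sqrt_pos.2 (by rw [hn']; positivity)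
  have hmin := sum_mul_le_l1 (h := bc - β) h2
  have hminc := sum_mul_le_l1 (h := b - β) c2
  have hR := mul_le_mul_of_nonneg_left (c3 bc hbc) hlam
  have hRc := mul_le_mul_of_nonneg_left (h3 b hb) hlam
  simp only [Fintype.card_coe, hJ] at h1
  simp only [Fintype.card_coe, hJc] at c1
  set u := ∑ i, weightError θ T i (fun k => covarTreat (restrictTo s J k))
    * resid β (restrictTo s J i) with hu
  set uc := ∑ i, weightError θ Tc i (fun k => covarTreat (restrictTo s Jᶜ k))
    * resid β (restrictTo s Jᶜ i) with huc
  set w := ∑ j, balance (fun i => covarTreat (restrictTo s J i))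
    (propEstimate T (restrictTo s J)) j * (bc - β) j with hw
  set wc := ∑ j, balance (fun i => covarTreat (restrictTo s Jᶜ i))
    (propEstimate Tc (restrictTo s Jᶜ)) j * (b - β) j with hwc
  set φ : Obs p → ℝ := fun o => ind (treat o) * resid β o * q (dot (covar o) θ)
    + dot (covar o) β with hφ
  have e1 : foldMean (restrictTo s J) (propEstimate T (restrictTo s J)) bc
      = 1 / (N : ℝ) * ∑ i ∈ J, φ (s i) + (1 / (N : ℝ) * u + w) := by
    rw [foldMean_eq β θ, Fintype.card_coe, hJ, ← Finset.sum_coe_sort J]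
    rfl
  have e2 : foldMean (restrictTo s Jᶜ) (propEstimate Tc (restrictTo s Jᶜ)) b
      = 1 / (N : ℝ) * ∑ i ∈ Jᶜ, φ (s i) + (1 / (N : ℝ) * uc + wc) := by
    rw [foldMean_eq β θ, Fintype.card_coe, hJc, ← Finset.sum_coe_sort Jᶜ]
    rfl
  have e3 : linearTerm P β θ s = 1 / Real.sqrt n * (∑ i ∈ J, φ (s i) + ∑ i ∈ Jᶜ, φ (s i))
      - Real.sqrt n * mu1 P := by
    unfold linearTerm
    rw [Finset.sum_add_sum_compl]
    have : ∑ i, (ind (treat (s i)) * resid β (s i) * q (dot (covar (s i)) θ)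
      + (dot (covar (s i)) β - mu1 P)) = ∑ i, φ (s i) - n * mu1 P := by
      simp_rw [← add_sub_assoc]
      rw [Finset.sum_sub_distrib]
      simp [hφ]
    rw [this, mul_sub]
    congr 1
    rw [one_div, ← mul_assoc]
    congr 1
    rw [inv_mul_eq_div, Real.div_sqrt]
  have e4 : 1 / Real.sqrt n = Real.sqrt n / (2 * N) := by
    rw [← hn', div_eq_div_iff hs0.ne' (by rw [hn']; positivity), one_mul,
      Real.mul_self_sqrt (by positivity)]
  have e5 : Real.sqrt (n : ℝ) * (muHat s J (propEstimate T (restrictTo s J))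
        (propEstimate Tc (restrictTo s Jᶜ)) b bc - mu1 P) - linearTerm P β θ s
      = Real.sqrt n / 2 * (1 / (N : ℝ) * (u + uc) + (w + wc)) := by
    unfold muHat
    rw [e1, e2, e3, e4]
    field_simp
    ring
  rw [e5, abs_mul, abs_of_pos (half_pos hs0)]
  have e6 : |1 / (N : ℝ) * (u + uc) + (w + wc)|
      ≤ 1 / (N : ℝ) * (2 * (δ * Real.sqrt N)) + 2 * (lamθ * R) := by
    refine (abs_add_le _ _).trans (add_le_add ?_ ?_)
    · rw [abs_mul, abs_of_nonneg (by positivity)]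
      refine mul_le_mul_of_nonneg_left ((abs_add_le _ _).trans ?_) (by positivity)
      linarith
    · refine (abs_add_le _ _).trans ?_
      linarith
  refine (mul_le_mul_of_nonneg_left e6 (half_pos hs0).le).trans (le_of_eq ?_)
  rw [hsn]
  have e7 : Real.sqrt N * Real.sqrt N = N := Real.mul_self_sqrt hN'.le
  field_simp
  linear_combination δ * e7

/-- A subsample of an i.i.d. sample is i.i.d.; the event need not be measurable. -/
theorem measure_pi_preimage_restrictTo_le [IsProbabilityMeasure P] {n : ℕ} (F : Finset (Fin n))
    (A : Set (F → Obs p)) :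
    (Measure.pi fun _ : Fin n => P) {s | restrictTo s F ∈ A}
      ≤ (Measure.pi fun _ : F => P) A := by
  have h1 := measurePreserving_piEquivPiSubtypeProd (fun _ : Fin n => P) (fun i => i ∈ F)
  have h2 : MeasurePreserving (fun s : Fin n → Obs p => restrictTo s F)
      (Measure.pi fun _ : Fin n => P) (Measure.pi fun _ : F => P) := by
    convert (measurePreserving_fst).comp h1
    rfl
  rw [← h2.map_eq]
  exact Measure.le_map_apply h2.measurable.aemeasurable A

end Expansion

/-! ### Rates -/

section Asymptotic

theorem two_mul_tuningRate_ge {m p : ℕ} (hm : 0 < m) :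
    Real.sqrt (Real.log p / m) ≤ 2 * tuningRate (2 * m) p := by
  have hm' : (0 : ℝ) < m := by exact_mod_cast hm
  have hL : 0 ≤ Real.log p := Real.log_natCast_nonneg p
  unfold tuningRate
  rw [Real.sqrt_le_left (by positivity), mul_pow, Real.sq_sqrt (by positivity)]
  push_cast
  rw [show (2 : ℝ) ^ 2 * (Real.log p / (2 * m)) = 2 * (Real.log p / m) by field_simp]
  have : 0 ≤ Real.log p / m := by positivity
  linarith

theorem tuningRate_le {m p : ℕ} : tuningRate (2 * m) p ≤ Real.sqrt (Real.log p / m) := by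
  have hL : 0 ≤ Real.log p := Real.log_natCast_nonneg p
  unfold tuningRate
  refine Real.sqrt_le_sqrt ?_
  rcases Nat.eq_zero_or_pos m with rfl | hm
  · simp
  have hm' : (0 : ℝ) < m := by exact_mod_cast hm
  push_cast
  gcongr
  linarith

/-- The fold-level conditions on a nonzero outcome parameter follow from ultra-sparsity, with `x`
the ratio of the sparsity to its bound. -/
theorem lasso_rate_of_sparse {m p s : ℕ} {B cG x : ℝ} (hm : 512 ≤ m) (hp : 3 ≤ p)
    (hx : (s : ℝ) * Real.log p = x * Real.sqrt ((2 * m : ℕ) : ℝ)) (hx1 : x ≤ 1)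
    (hxB : 32 * (32 * B ^ 2) * 2 * x ≤ cG) :
    s = 0 ∨ (16 * Real.log p ≤ m ∧
      32 * (32 * B ^ 2 * Real.sqrt (Real.log p / m)) * s ≤ cG) := by
  rcases Nat.eq_zero_or_pos s with hs | hs
  · exact Or.inl hs
  right
  have hm' : (512 : ℝ) ≤ m := by exact_mod_cast hm
  have hs' : (1 : ℝ) ≤ s := by exact_mod_cast hs
  have hlog : 1 ≤ Real.log p := by
    rw [Real.le_log_iff_exp_le (by positivity)]
    have h3 : (3 : ℝ) ≤ p := by exact_mod_cast hp
    linarith [Real.exp_one_lt_d9]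
  push_cast at hx
  have hsq : Real.sqrt (2 * (m : ℝ)) * Real.sqrt (2 * m) = 2 * m :=
    Real.mul_self_sqrt (by positivity)
  have h32 : 32 ≤ Real.sqrt (2 * (m : ℝ)) := by
    refine Real.le_sqrt_of_sq_le ?_
    linarith
  constructor
  · have h1 : Real.log p ≤ Real.sqrt (2 * (m : ℝ)) := by
      calc Real.log p ≤ s * Real.log p := le_mul_of_one_le_left (by linarith) hs'
        _ = x * Real.sqrt (2 * m) := hx
        _ ≤ _ := mul_le_of_le_one_left (Real.sqrt_nonneg _) hx1
    nlinarith
  · have h2 : Real.sqrt (Real.log p / m) * s ≤ 2 * x := by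
      have hm0 : 0 < Real.sqrt (m : ℝ) := Real.sqrt_pos.2 (by linarith)
      have h3 : Real.sqrt (Real.log p) ≤ Real.log p := by
        rw [Real.sqrt_le_left (by linarith)]
        nlinarith
      have hx0 : 0 ≤ x := by
        by_contra hneg
        nlinarith [mul_neg_of_neg_of_pos (not_le.1 hneg)
            (by linarith : 0 < Real.sqrt (2 * (m : ℝ))),
          mul_pos (by linarith : (0 : ℝ) < s) (by linarith : 0 < Real.log p)]
      rw [Real.sqrt_div (by linarith), div_mul_eq_mul_div, div_le_iff₀ hm0]
      calc Real.sqrt (Real.log p) * s ≤ Real.log p * s := by gcongr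
        _ = x * (Real.sqrt 2 * Real.sqrt m) := by
            rw [← Real.sqrt_mul (by norm_num), ← hx, mul_comm]
        _ ≤ x * (2 * Real.sqrt m) := by
            gcongr
            rw [Real.sqrt_le_left (by norm_num)]
            norm_num
        _ = 2 * x * Real.sqrt m := by ring
    calc 32 * (32 * B ^ 2 * Real.sqrt (Real.log p / m)) * s
        = 32 * (32 * B ^ 2) * (Real.sqrt (Real.log p / m) * s) := by ring
      _ ≤ 32 * (32 * B ^ 2) * (2 * x) := by gcongr
      _ ≤ cG := by linarith

theorem l0_pos_of_ne_zero {p : ℕ} {t : Fin p → ℝ} (h : t ≠ 0) : 1 ≤ l0 t := by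
  obtain ⟨j, hj⟩ := Function.ne_iff.1 h
  exact (Set.ncard_pos (Set.toFinite _)).2 ⟨j, hj⟩

end Asymptotic

end BalancedATE

end

/-! ### The asymptotic expansion -/

open BalancedATE in
theorem theorem2 (a b cmin cmax KX Kε r κ : ℝ) (hcmin : 0 < cmin) :
    -- how large the tuning parameters have to be depends only on the constants above
    ∃ C₀ : ℝ, 0 < C₀ ∧ ∀ C₁ : ℝ,
    -- the m-th experiment: sample size n = 2 m, dimension p m, law P m of one observation
    ∀ (p : ℕ → ℕ) (P : ∀ m, Measure (BalancedATE.Obs (p m)))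
      (_ : ∀ m, IsProbabilityMeasure (P m)) (β θ : ∀ m, Fin (p m) → ℝ)
      (J : ∀ m, Finset (Fin (2 * m))) (lamθ lamβ : ℕ → ℝ)
      (thetaHat : ∀ m (F : Finset (Fin (2 * m))),
        (F → (Fin (p m) → ℝ) × Bool) → Fin (p m) → ℝ)
      (betaHat : ∀ m, Finset (Fin (2 * m)) →
        (Fin (2 * m) → BalancedATE.Obs (p m)) → Fin (p m) → ℝ),
    Tendsto p atTop atTop →
    -- the model and its assumptions
    (∀ m, BalancedATE.LinearLogistic (P m) (β m) (θ m)) →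
    (∀ m, BalancedATE.CovariatesIn (P m) a b) →
    (∀ m, BalancedATE.EigenvalueAssumption (P m) cmin cmax) →
    (∀ m, BalancedATE.ModelAssumption (P m) (β m) KX Kε) →
    (∀ m, BalancedATE.l1 (θ m) ≤ r) →
    (∀ m, BalancedATE.l1 (θ m) ≤ κ) →
    -- sparsity
    ((fun m => (BalancedATE.l0 (β m) : ℝ)) =o[atTop]
      fun m => Real.sqrt ((2 * m : ℕ) : ℝ) / Real.log (p m)) →
    ((fun m => (BalancedATE.l0 (θ m) : ℝ)) =o[atTop]
      fun m => ((2 * m : ℕ) : ℝ) / Real.log (p m)) →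
    -- the split, the tuning parameters and the estimators
    (∀ m, (J m).card = m) →
    (∀ᶠ m in atTop, lamθ m ∈ Set.Icc (C₀ * BalancedATE.tuningRate (2 * m) (p m))
      (C₁ * BalancedATE.tuningRate (2 * m) (p m))) →
    (∀ᶠ m in atTop, lamβ m ∈ Set.Icc (C₀ * BalancedATE.tuningRate (2 * m) (p m))
      (C₁ * BalancedATE.tuningRate (2 * m) (p m))) →
    (∀ m F, F = J m ∨ F = (J m)ᶜ →
      BalancedATE.IsPropensityEstimator F (lamθ m) κ (thetaHat m F)) →
    (∀ m F, F = J m ∨ F = (J m)ᶜ → ∀ s,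
      BalancedATE.SelectsArgmin
        (BalancedATE.outcomeLoss (BalancedATE.restrictTo s F)
          (thetaHat m F (BalancedATE.propSample s F)) (lamβ m))
        Set.univ (betaHat m F s)) →
    -- √n (μ̂ - μ) - n^{-1/2} ∑ᵢ [Wᵢ εᵢ q(Xᵢ'θ) + Xᵢ'β - μ] = o_P(1), for an i.i.d. sample
    BalancedATE.IsLittleOP
      (fun m => Measure.pi fun _ : Fin (2 * m) => P m)
      (fun m s =>
        Real.sqrt ((2 * m : ℕ) : ℝ) *
          (BalancedATE.muHat s (J m)
              (thetaHat m (J m) (BalancedATE.propSample s (J m)))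
              (thetaHat m (J m)ᶜ (BalancedATE.propSample s (J m)ᶜ))
              (betaHat m (J m) s) (betaHat m (J m)ᶜ s)
            - BalancedATE.mu1 (P m))
        - BalancedATE.linearTerm (P m) (β m) (θ m) s) := by
  set B : ℝ := |a| + |b| + 1 with hBdef
  have hB0 : 0 < B := by positivity
  set M : ℝ := Real.exp (B * κ) with hM
  have hM0 : 0 < M := Real.exp_pos _
  set cG : ℝ := cmin / (1 + Real.exp (B * κ)) with hcG
  have hcG0 : 0 < cG := by positivity
  -- the constant serves both penalties: the noise levels are `16 B M` and `8 B M Kε` times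
  -- `√(log p / m)`, which is at most twice the rate for the sample size `2 m`
  refine ⟨64 * B * M * (|Kε| + 1), by positivity, ?_⟩
  intro C₁ p P hP β θ J lamθ lamβ thetaHat betaHat hp hL hX hE hMod _ hκ hsβ hsθ hJ hlθ hlβ hth hbh
  -- `x` and `y` are the sparsities of `β` and `θ` relative to their bounds
  set x : ℕ → ℝ := fun m => (l0 (β m) : ℝ) / (Real.sqrt ((2 * m : ℕ) : ℝ) / Real.log (p m)) with hx
  set y : ℕ → ℝ := fun m => (l0 (θ m) : ℝ) / (((2 * m : ℕ) : ℝ) / Real.log (p m)) with hy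
  have hx0 : Tendsto x atTop (𝓝 0) := hsβ.tendsto_div_nhds_zero
  have hy0 : Tendsto y atTop (𝓝 0) := hsθ.tendsto_div_nhds_zero
  -- a bound for the mean square of the weight errors; the last summand keeps it positive
  set η : ℕ → ℝ := fun m => 3 * κ * M * |C₁| * Real.sqrt (2 * y m) + 1 / ((m : ℝ) + 1) with hη
  have hη0 : Tendsto η atTop (𝓝 0) := by
    have h1 : Tendsto (fun m => Real.sqrt (2 * y m)) atTop (𝓝 0) := by
      have := (Real.continuous_sqrt.tendsto _).comp (hy0.const_mul 2)
      rwa [mul_zero, Real.sqrt_zero] at this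
    have := (h1.const_mul (3 * κ * M * |C₁|)).add (tendsto_one_div_add_atTop_nhds_zero_nat (𝕜 := ℝ))
    rwa [mul_zero, add_zero] at this
  intro δ₀ hδ₀
  set δ : ℝ := δ₀ / 4 with hδ
  have hδ0 : 0 < δ := by positivity
  set bnd : ℕ → ℝ := fun m => 6 * Real.exp (-Real.log (p m)) + Real.exp (-(1 / 4) * (m : ℝ))
    + Real.sqrt (η m) * (M ^ 2 + 4 * Kε ^ 4) / δ ^ 2 with hbnd
  have hlogp : Tendsto (fun m => Real.log (p m)) atTop atTop :=
    Real.tendsto_log_atTop.comp (tendsto_natCast_atTop_atTop.comp hp)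
  have hbnd0 : Tendsto bnd atTop (𝓝 0) := by
    have h1 : Tendsto (fun m => Real.exp (-Real.log (p m))) atTop (𝓝 0) :=
      Real.tendsto_exp_neg_atTop_nhds_zero.comp hlogp
    have h2 : Tendsto (fun m : ℕ => Real.exp (-(1 / 4) * (m : ℝ))) atTop (𝓝 0) := by
      have : Tendsto (fun m : ℕ => 1 / 4 * (m : ℝ)) atTop atTop :=
        tendsto_natCast_atTop_atTop.const_mul_atTop (by norm_num)
      refine (Real.tendsto_exp_neg_atTop_nhds_zero.comp this).congr fun m => ?_
      simp [neg_mul]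
    have h3 : Tendsto (fun m => Real.sqrt (η m)) atTop (𝓝 0) := by
      have := (Real.continuous_sqrt.tendsto _).comp hη0
      rwa [Real.sqrt_zero] at this
    have := ((h1.const_mul 6).add h2).add ((h3.mul_const (M ^ 2 + 4 * Kε ^ 4)).div_const (δ ^ 2))
    rwa [mul_zero, zero_mul, zero_div, add_zero, add_zero] at this
  have hlim : Tendsto (fun m => ENNReal.ofReal (bnd m) + ENNReal.ofReal (bnd m)) atTop (𝓝 0) := by
    have := ENNReal.tendsto_ofReal hbnd0
    simpa using this.add this
  refine tendsto_of_tendsto_of_tendsto_of_le_of_le' tendsto_const_nhds hlim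
    (Eventually.of_forall fun m => zero_le) ?_
  have hxev : ∀ c : ℝ, 0 < c → ∀ᶠ m in atTop, x m ≤ c := fun c hc =>
    (hx0.eventually (gt_mem_nhds hc)).mono fun m hm => hm.le
  filter_upwards [hlθ, hlβ, eventually_ge_atTop 512, hp.eventually_ge_atTop 3, hxev 1 one_pos,
    hxev (cG / (32 * (32 * B ^ 2) * 2)) (by positivity),
    hxev (δ / (12 * C₁ ^ 2 * M / cG + 1)) (by positivity)]
    with m hmθ hmβ hm hpm hx1 hx2 hx3
  have hm0 : 0 < m := by omega
  have hm' : (0 : ℝ) < m := by exact_mod_cast hm0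
  have hlog0 : 0 < Real.log (p m) := Real.log_pos (by exact_mod_cast (by omega : 1 < p m))
  have hK : 0 < Kε := (hMod m).resid_subgaussian.1
  have hκ0 : 0 ≤ κ := (l1_nonneg (θ m)).trans (hκ m)
  have hB : ∀ᵐ o ∂(P m), ∀ j, |covar o j| ≤ B := by
    filter_upwards [hX m] with o ho j
    have h1 := (ho j).1
    have h2 := (ho j).2
    rw [abs_le, hBdef]
    constructor <;> linarith [neg_abs_le a, le_abs_self b, abs_nonneg a, abs_nonneg b]
  set ρ := Real.sqrt (Real.log (p m) / m) with hρ
  set rate := tuningRate (2 * m) (p m) with hrate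
  have hrate0 : 0 < rate := Real.sqrt_pos.2 (by push_cast; positivity)
  have hρle : ρ ≤ 2 * rate := two_mul_tuningRate_ge hm0
  have hrρ : rate ≤ ρ := tuningRate_le
  have hlθ1 : 32 * B * M * ρ ≤ lamθ m := by
    refine le_trans ?_ hmθ.1
    rw [abs_of_pos hK]
    calc 32 * B * M * ρ ≤ 32 * B * M * (2 * rate) := by gcongr
      _ = 64 * B * M * 1 * rate := by ring
      _ ≤ 64 * B * M * (Kε + 1) * rate := by gcongr; linarith
  have hlβ1 : 32 * B * M * Kε * ρ ≤ lamβ m := by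
    refine le_trans ?_ hmβ.1
    rw [abs_of_pos hK]
    calc 32 * B * M * Kε * ρ ≤ 32 * B * M * Kε * (2 * rate) := by gcongr
      _ = 64 * B * M * Kε * rate := by ring
      _ ≤ 64 * B * M * (Kε + 1) * rate := by gcongr; linarith
  have hρ0 : 0 < ρ := hrate0.trans_le hrρ
  have hlθ0 : 0 < lamθ m := lt_of_lt_of_le (by positivity) hlθ1
  have hlβ0 : 0 < lamβ m := lt_of_lt_of_le (by positivity) hlβ1
  have hlθ2 : lamθ m ≤ |C₁| * rate :=
    hmθ.2.trans (mul_le_mul_of_nonneg_right (le_abs_self _) hrate0.le)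
  have hlβ2 : lamβ m ≤ |C₁| * rate :=
    hmβ.2.trans (mul_le_mul_of_nonneg_right (le_abs_self _) hrate0.le)
  have hxm : (l0 (β m) : ℝ) * Real.log (p m) = x m * Real.sqrt ((2 * m : ℕ) : ℝ) := by
    have : 0 < Real.sqrt ((2 * m : ℕ) : ℝ) := Real.sqrt_pos.2 (by push_cast; positivity)
    simp only [hx]; field_simp
  have hη1 : 0 < η m := by
    simp only [hη]; positivity
  have hηθ : θ m = 0 ∨ 3 * κ * M * lamθ m ≤ η m := by
    by_cases h0 : θ m = 0
    · exact Or.inl h0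
    right
    have h1 : (1 : ℝ) ≤ l0 (θ m) := by exact_mod_cast l0_pos_of_ne_zero h0
    have h2 : ρ ≤ Real.sqrt (2 * y m) := by
      refine Real.sqrt_le_sqrt ?_
      have : 2 * y m = l0 (θ m) * (Real.log (p m) / m) := by
        simp only [hy]; push_cast; field_simp
      rw [this]
      exact le_mul_of_one_le_left (by positivity) h1
    calc 3 * κ * M * lamθ m ≤ 3 * κ * M * (|C₁| * Real.sqrt (2 * y m)) := by
          gcongr
          exact hlθ2.trans (mul_le_mul_of_nonneg_left (hrρ.trans h2) (abs_nonneg _))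
      _ ≤ η m := by
          simp only [hη]
          have : 0 < 1 / ((m : ℝ) + 1) := by positivity
          linarith
  have hs := lasso_rate_of_sparse (B := B) (cG := cG) hm hpm hxm hx1 (by
    rw [le_div_iff₀ (by positivity)] at hx2
    linarith)
  set R : ℝ := 12 * l0 (β m) * lamβ m / (M⁻¹ * cG) with hR
  have hJc : (J m)ᶜ.card = m := by
    rw [Finset.card_compl, Fintype.card_fin, hJ m]; omega
  have hfold : ∀ F : Finset (Fin (2 * m)), F.card = m → (F = J m ∨ F = (J m)ᶜ) →
      (Measure.pi fun _ : F => P m) {d | ¬ FoldGood (β m) (θ m) (thetaHat m F) (lamθ m) (lamβ m)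
        δ R d} ≤ ENNReal.ofReal (bnd m) := by
    intro F hF hFJ
    have hcard : Fintype.card F = m := by rw [Fintype.card_coe, hF]
    have := measure_pi_not_foldGood_le (ι := F) (hL m) hB hB0 (hMod m).resid_subgaussian (hE m)
      hcmin (hκ m) (by omega) (by omega) hcG (T := thetaHat m F) (hth m F hFJ).1 (hth m F hFJ).2
      (lamβ := lamβ m) (η := η m) (δ := δ) (by rw [hcard]; exact hlθ1) (by rw [hcard]; exact hlβ1)
      hη1 hδ0 hηθ (by rw [hcard]; exact hs)
    rw [hcard] at this
    exact this
  have hRsmall : Real.sqrt ((2 * m : ℕ) : ℝ) * (lamθ m * R) ≤ δ := by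
    set n : ℝ := ((2 * m : ℕ) : ℝ) with hn
    have hn0 : 0 < n := by rw [hn]; push_cast; positivity
    have hsn : 0 < Real.sqrt n := Real.sqrt_pos.2 hn0
    have hr2 : rate * rate = Real.log (p m) / n :=
      Real.mul_self_sqrt (div_nonneg hlog0.le hn0.le)
    have hsq : Real.sqrt n * Real.sqrt n = n := Real.mul_self_sqrt hn0.le
    have h1 : lamθ m * lamβ m ≤ C₁ ^ 2 * (Real.log (p m) / n) := by
      calc lamθ m * lamβ m ≤ (|C₁| * rate) * (|C₁| * rate) := by gcongr
        _ = |C₁| ^ 2 * (rate * rate) := by ring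
        _ = _ := by rw [hr2, sq_abs]
    have hxnn : 0 ≤ x m := by simp only [hx]; positivity
    calc Real.sqrt n * (lamθ m * R)
        = 12 * M / cG * (Real.sqrt n * l0 (β m)) * (lamθ m * lamβ m) := by
          rw [hR]; field_simp
      _ ≤ 12 * M / cG * (Real.sqrt n * l0 (β m)) * (C₁ ^ 2 * (Real.log (p m) / n)) := by gcongr
      _ = 12 * C₁ ^ 2 * M / cG * (Real.sqrt n * (l0 (β m) * Real.log (p m)) / n) := by ring
      _ = 12 * C₁ ^ 2 * M / cG * x m := by
          rw [hxm]
          congr 1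
          rw [mul_comm (x m), ← mul_assoc, hsq]; field_simp
      _ ≤ (12 * C₁ ^ 2 * M / cG + 1) * x m := by gcongr; linarith
      _ ≤ δ := by
          rw [le_div_iff₀ (by positivity)] at hx3
          linarith
  -- the event may fail to be measurable, as the outcome estimates are arbitrary selections;
  -- it is contained in the union of the bad events of the two folds
  refine le_trans (measure_mono (t := {s | restrictTo s (J m) ∈ {d | ¬ FoldGood (β m) (θ m)
      (thetaHat m (J m)) (lamθ m) (lamβ m) δ R d}} ∪ {s | restrictTo s (J m)ᶜ ∈ {d | ¬ FoldGood
      (β m) (θ m) (thetaHat m (J m)ᶜ) (lamθ m) (lamβ m) δ R d}}) ?_)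
    ((measure_union_le _ _).trans (add_le_add
      ((measure_pi_preimage_restrictTo_le _ _).trans (hfold _ (hJ m) (Or.inl rfl)))
      ((measure_pi_preimage_restrictTo_le _ _).trans (hfold _ hJc (Or.inr rfl)))))
  intro s (hs : δ₀ ≤ |_|)
  by_contra hcon
  simp only [Set.mem_union, Set.mem_ofPred_eq, not_or, not_not] at hcon
  have hmain := abs_expansion_error_le (P := P m) rfl hm0 s (hJ m) hJc hlθ0.le hcon.1 hcon.2
    (hbh m _ (Or.inl rfl) s (exists_isMinOn_outcomeLoss _ _ hlβ0)).2
    (hbh m _ (Or.inr rfl) s (exists_isMinOn_outcomeLoss _ _ hlβ0)).2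
  have hsqrt2 : Real.sqrt 2 ≤ 2 := by
    rw [Real.sqrt_le_left (by norm_num)]; norm_num
  have := hs.trans hmain
  nlinarith
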